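/- Let $0<q<1$, $r<0$, $c>0$ and $d\in\mathbb R\setminus\{0\}$, and put, for $k\in\mathbb Z$, $$a_k=\tfrac12\sqrt{\Bigl(1-\frac{q^{-k}}{r}\Bigr)\Bigl(1-\frac{c\,q^{-k}}{d^2r}\Bigr)},\qquad b_k=\frac{q^{-k}(c+q)}{2dr}.$$ Let $L$ be the doubly infinite Jacobi operator on $\ell^2(\mathbb Z)$ whose domain is the space of finite linear combinations of the standard basis vectors $e_k$, given by $Le_k=a_ke_{k+1}+b_ke_k+a_{k-1}e_{k-1}$. For an arbitrary sequence $u=(u_k)_{k\in\mathbb Z}$ of complex numbers put $(L^*u)_k=a_ku_{k+1}+b_ku_k+a_{k-1}u_{k-1}$, and for $z\in\mathbb C\setminus\mathbb R$ let $$S^-_z=\Bigl\{u : L^*u=zu,\ \sum_{k\le -1}|u_k|^2<\infty\Bigr\},\qquad S^+_z=\Bigl\{u : L^*u=zu,\ \sum_{k\ge 0}|u_k|^2<\infty\Bigr\}.$$ Write $(a;q)_k=\prod_{i=0}^{k-1}(1-aq^i)$ for $k\in\{0,1,2,\dots\}\cup\{\infty\}$, and let ${}_2\varphi_1(\alpha,\beta;\gamma;q,x)$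 be the analytic continuation to $x\in\mathbb C\setminus[1,\infty)$ of $\sum_{k\ge0}\frac{(\alpha;q)_k(\beta;q)_k}{(q;q)_k(\gamma;q)_k}x^k$. Put $\mu(y)=\frac12(y+y^{-1})$ and $$w_k=d^k\sqrt{\frac{(cq^{1-k}/d^2r;q)_\infty}{(q^{1-k}/r;q)_\infty}},\qquad f_k(\mu(y))={}_2\varphi_1(dy,d/y;c;q,rq^k),$$ $$g_k(\mu(y))=q^kc^{-k}\,{}_2\varphi_1(qdy/c,qd/cy;q^2/c;q,rq^k),$$ $$F_k(y)=(dy)^{-k}\,{}_2\varphi_1\Bigl(dy,qdy/c;qy^2;q,\frac{q^{1-k}c}{d^2r}\Bigr).$$ Write $wf(z)$, $wg(z)$ and $wF(y)$ for the sequences $(w_kf_k(z))_k$, $(w_kg_k(z))_k$ and $(w_kF_k(y))_k$. Then: 1. If $0<c\le q^2$, then $L$ is essentially self-adjoint. If $q^2<c<1$, then $L$ has deficiency indices $(1,1)$. 2. For every $z\in\mathbb C\setminus\mathbb R$ there is exactly one $y$ with $|y|<1$ and $\mu(y)=z$; the space $S^-_z$ is one-dimensional and is spanned by $wF(y)$.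 3. Let $z\in\mathbb C\setminus\mathbb R$. If $0<c\le q^2$, then $S^+_z$ is one-dimensional and is spanned by $wf(z)$. If $q^2<c<1$, then $S^+_z$ is two-dimensional and, if moreover $c\ne q$, it is spanned by $wf(z)$ and $wg(z)$. -/

import Mathlib

open scoped lp

noncomputable section

namespace DoublyInfiniteJacobi

/-! ### Unbounded operators: essential self-adjointness and deficiency indices -/

section Operators

variable {H : Type*} [NormedAddCommGroup H] [InnerProductSpace ℂ H] [CompleteSpace H]

/-- A densely defined symmetric operator is essentially self-adjoint if its closure is
self-adjoint. -/
def IsEssentiallySelfAdjoint (T : H →ₗ.[ℂ] H) : Prop :=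
  Dense (T.domain : Set H) ∧ T.IsFormalAdjoint T ∧ T.IsClosable ∧ IsSelfAdjoint T.closure

/-- The eigenspace `N_z = {v ∈ D(T*) | T* v = z v}` of the adjoint. -/
def deficiencySpace (T : H →ₗ.[ℂ] H) (z : ℂ) : Submodule ℂ H where
  carrier := {v | ∃ hv : v ∈ T.adjoint.domain, T.adjoint ⟨v, hv⟩ = z • v}
  zero_mem' := ⟨Submodule.zero_mem _, by
    rw [smul_zero]; exact T.adjoint.map_zero⟩
  add_mem' := by
    rintro u v ⟨hu, hu'⟩ ⟨hv, hv'⟩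
    refine ⟨Submodule.add_mem _ hu hv, ?_⟩
    have h := T.adjoint.map_add ⟨u, hu⟩ ⟨v, hv⟩
    rw [hu', hv'] at h
    rw [smul_add]
    exact h
  smul_mem' := by
    rintro s u ⟨hu, hu'⟩
    refine ⟨Submodule.smul_mem _ s hu, ?_⟩
    have h := T.adjoint.map_smul s ⟨u, hu⟩
    rw [hu', smul_comm] at h
    exact h

/-- A densely defined symmetric operator `T` has deficiency indices
`(n₊, n₋) = (dim N_i, dim N_{-i})`. -/
def HasDeficiencyIndices (T : H →ₗ.[ℂ] H) (m n : ℕ) : Prop :=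
  Dense (T.domain : Set H) ∧ T.IsFormalAdjoint T ∧
    Module.rank ℂ (deficiencySpace T Complex.I) = m ∧
    Module.rank ℂ (deficiencySpace T (-Complex.I)) = n

end Operators

/-! ### Doubly infinite Jacobi operators -/

/-- The recurrence `(L* v)_k = a_k v_{k+1} + b_k v_k + a_{k-1} v_{k-1}` on arbitrary sequences. -/
def jacobiAction (a b : ℤ → ℝ) : (ℤ → ℂ) →ₗ[ℂ] (ℤ → ℂ) where
  toFun v k := a k * v (k + 1) + b k * v k + a (k - 1) * v (k - 1)
  map_add' _ _ := by ext k; simp only [Pi.add_apply]; ring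
  map_smul' _ _ := by
    ext k; simp only [Pi.smul_apply, smul_eq_mul, RingHom.id_apply]; ring

/-- The space of finite linear combinations of the standard basis vectors `e_k` of `ℓ²(ℤ)`,
that is, of the finitely supported sequences. -/
def finiteSequences : Submodule ℂ ℓ²(ℤ, ℂ) where
  carrier := {v | (Function.support (v : ℤ → ℂ)).Finite}
  zero_mem' := by
    change (Function.support (0 : ℤ → ℂ)).Finite
    simp
  add_mem' := by
    intro u v hu hv
    exact (Set.Finite.union hu hv).subset (by
      rw [lp.coeFn_add]; exact Function.support_add _ _)
  smul_mem' := by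
    intro s v hv
    exact Set.Finite.subset hv (by
      rw [lp.coeFn_smul]; exact Function.support_const_smul_subset s _)

theorem finiteSequences_eq_span :
    finiteSequences = Submodule.span ℂ
      (Set.range fun k : ℤ => (lp.single 2 k (1 : ℂ) : ℓ²(ℤ, ℂ))) := by
  apply le_antisymm
  · intro v hv
    have hfin : (Function.support (v : ℤ → ℂ)).Finite := hv
    have hsum : v = ∑ k ∈ hfin.toFinset, (v k) • (lp.single 2 k (1 : ℂ) : ℓ²(ℤ, ℂ)) := by
      ext l
      rw [lp.coeFn_sum, Finset.sum_apply]
      simp only [lp.coeFn_smul, Pi.smul_apply, lp.single_apply, smul_eq_mul]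
      by_cases hl : v l = 0
      · rw [hl]
        symm
        apply Finset.sum_eq_zero
        intro k hk
        have hk' : v k ≠ 0 := by simpa using hk
        have hkl : l ≠ k := by rintro rfl; exact hk' hl
        simp [Pi.single_eq_of_ne hkl]
      · rw [Finset.sum_eq_single l]
        · simp
        · intro k _ hkl
          simp [Pi.single_eq_of_ne hkl.symm]
        · intro h
          simp at h
          exact absurd h hl
    rw [hsum]
    exact Submodule.sum_mem _ fun k _ =>
      Submodule.smul_mem _ _ (Submodule.subset_span ⟨k, rfl⟩)
  · rw [Submodule.span_le]
    rintro _ ⟨k, rfl⟩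
    refine (Set.finite_singleton k).subset ?_
    intro l hl
    by_contra hne
    apply hl
    have : l ≠ k := hne
    rw [lp.single_apply]
    simp [Pi.single_eq_of_ne this]

theorem support_jacobiAction_finite (a b : ℤ → ℝ) {v : ℤ → ℂ}
    (hv : (Function.support v).Finite) :
    (Function.support (jacobiAction a b v)).Finite := by
  have h1 : ((fun k : ℤ => k - 1) '' Function.support v ∪ Function.support v ∪
      (fun k : ℤ => k + 1) '' Function.support v).Finite :=
    ((hv.image _).union hv).union (hv.image _)
  refine h1.subset ?_
  intro k hk
  by_contra hne
  apply hk
  simp only [Set.mem_union, Set.mem_image, Function.mem_support, not_or, not_exists, not_and,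
    not_not] at hne
  obtain ⟨⟨hA, hB⟩, hC⟩ := hne
  have h2 : v (k + 1) = 0 := by
    by_contra h; exact hA (k + 1) h (by ring)
  have h3 : v (k - 1) = 0 := by
    by_contra h; exact hC (k - 1) h (by ring)
  simp [jacobiAction, h2, h3, hB]

theorem memℓp_of_finite_support {v : ℤ → ℂ} (hv : (Function.support v).Finite) :
    Memℓp v 2 :=
  (memℓp_zero hv).of_exponent_ge (by simp)

/-- The doubly infinite Jacobi operator `L` with domain the finite linear combinations of the
`e_k`, acting by `L e_k = a_k e_{k+1} + b_k e_k + a_{k-1} e_{k-1}`. -/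
def jacobiOperator (a b : ℤ → ℝ) : ℓ²(ℤ, ℂ) →ₗ.[ℂ] ℓ²(ℤ, ℂ) where
  domain := finiteSequences
  toFun :=
    { toFun := fun v => ⟨jacobiAction a b (v : ℓ²(ℤ, ℂ)),
        memℓp_of_finite_support (support_jacobiAction_finite a b v.2)⟩
      map_add' := fun _ _ => Subtype.ext ((jacobiAction a b).map_add _ _)
      map_smul' := fun s _ => Subtype.ext ((jacobiAction a b).map_smul s _) }

theorem summable_norm_sq_add {u v : ℕ → ℂ} (hu : Summable fun n => ‖u n‖ ^ 2)
    (hv : Summable fun n => ‖v n‖ ^ 2) : Summable fun n => ‖u n + v n‖ ^ 2 := by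
  refine Summable.of_nonneg_of_le (fun n => by positivity) (fun n => ?_)
    ((hu.mul_left 2).add (hv.mul_left 2))
  have h := norm_add_le (u n) (v n)
  nlinarith [norm_nonneg (u n + v n), norm_nonneg (u n), norm_nonneg (v n),
    sq_nonneg (‖u n‖ - ‖v n‖)]

theorem summable_norm_sq_smul {u : ℕ → ℂ} (s : ℂ) (hu : Summable fun n => ‖u n‖ ^ 2) :
    Summable fun n => ‖s * u n‖ ^ 2 := by
  simpa only [norm_mul, mul_pow] using hu.mul_left (‖s‖ ^ 2)

/-- `S⁻_z`: all sequences with `L* f = z f` and `∑_{k ≤ -1} |f_k|² < ∞`. -/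
def solMinus (a b : ℤ → ℝ) (z : ℂ) : Submodule ℂ (ℤ → ℂ) where
  carrier := {f | jacobiAction a b f = z • f ∧ Summable fun n : ℕ => ‖f (-(n : ℤ) - 1)‖ ^ 2}
  zero_mem' := ⟨by simp, by simp⟩
  add_mem' := by
    rintro u v ⟨hu, hu'⟩ ⟨hv, hv'⟩
    exact ⟨by rw [map_add, hu, hv, smul_add], summable_norm_sq_add hu' hv'⟩
  smul_mem' := by
    rintro s u ⟨hu, hu'⟩
    exact ⟨by rw [map_smul, hu, smul_comm], summable_norm_sq_smul s hu'⟩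

/-- `S⁺_z`: all sequences with `L* f = z f` and `∑_{k ≥ 0} |f_k|² < ∞`. -/
def solPlus (a b : ℤ → ℝ) (z : ℂ) : Submodule ℂ (ℤ → ℂ) where
  carrier := {f | jacobiAction a b f = z • f ∧ Summable fun n : ℕ => ‖f (n : ℤ)‖ ^ 2}
  zero_mem' := ⟨by simp, by simp⟩
  add_mem' := by
    rintro u v ⟨hu, hu'⟩ ⟨hv, hv'⟩
    exact ⟨by rw [map_add, hu, hv, smul_add], summable_norm_sq_add hu' hv'⟩
  smul_mem' := by
    rintro s u ⟨hu, hu'⟩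
    exact ⟨by rw [map_smul, hu, smul_comm], summable_norm_sq_smul s hu'⟩

/-! ### Basic hypergeometric series -/

/-- The finite `q`-shifted factorial `(a;q)_k`. -/
def qPoch {R : Type*} [CommRing R] (a q : R) (k : ℕ) : R :=
  ∏ i ∈ Finset.range k, (1 - a * q ^ i)

/-- The infinite `q`-shifted factorial `(a;q)_∞`. -/
def qPochInf (a q : ℝ) : ℝ := ∏' i : ℕ, (1 - a * q ^ i)

/-- The series `∑_k (a,b;q)_k / (q,c;q)_k x^k`, which defines `₂φ₁(a,b;c;q,x)` for `|x| < 1`. -/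
def phiSeries (a b c q x : ℂ) : ℂ :=
  ∑' k : ℕ, qPoch a q k * qPoch b q k / (qPoch q q k * qPoch c q k) * x ^ k

/-- The cut plane `ℂ \ [1,∞)`. -/
def cutPlane : Set ℂ := (Complex.ofReal '' Set.Ici (1 : ℝ))ᶜ

/-- `φ` is an analytic continuation of the `₂φ₁`-series to `ℂ \ [1,∞)`. -/
def IsPhiContinuation (a b c q : ℂ) (φ : ℂ → ℂ) : Prop :=
  AnalyticOnNhd ℂ φ cutPlane ∧ ∀ x : ℂ, ‖x‖ < 1 → φ x = phiSeries a b c q x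

/-- Analytic continuations are unique on the cut plane, so `twoPhiOne` below does not depend on
any choice there. -/
theorem IsPhiContinuation.eqOn {a b c q : ℂ} {φ ψ : ℂ → ℂ}
    (hφ : IsPhiContinuation a b c q φ) (hψ : IsPhiContinuation a b c q ψ) :
    Set.EqOn φ ψ cutPlane := by
  have h0 : (0 : ℂ) ∈ cutPlane := by
    intro hmem
    obtain ⟨t, ht, h⟩ := hmem
    rw [Complex.ofReal_eq_zero] at h
    subst h
    exact absurd ht (by norm_num)
  have hstar : StarConvex ℝ (0 : ℂ) cutPlane := by
    rw [starConvex_zero_iff]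
    intro x hx s hs0 hs1 hmem
    obtain ⟨t, ht, h⟩ := hmem
    rcases hs0.eq_or_lt with rfl | hs
    · rw [zero_smul, Complex.ofReal_eq_zero] at h
      subst h
      exact absurd ht (by norm_num)
    · apply hx
      refine ⟨t / s, ?_, ?_⟩
      · rw [Set.mem_Ici, le_div_iff₀ hs]
        have : (1 : ℝ) ≤ t := ht
        linarith
      · rw [Complex.real_smul] at h
        have hs' : (s : ℂ) ≠ 0 := by exact_mod_cast hs.ne'
        rw [Complex.ofReal_div, h]
        field_simp
  have hconn : IsPreconnected cutPlane :=
    (hstar.isPathConnected h0).isConnected.isPreconnected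
  refine hφ.1.eqOn_of_preconnected_of_eventuallyEq hψ.1 hconn h0 ?_
  filter_upwards [Metric.ball_mem_nhds (0 : ℂ) one_pos] with x hx
  have hx' : ‖x‖ < 1 := by simpa using hx
  rw [hφ.2 x hx', hψ.2 x hx']

open Classical in
/-- `₂φ₁(a,b;c;q,x)` on `ℂ \ [1,∞)`: the value at `x` of the analytic continuation of the
series. -/
def twoPhiOne (a b c q x : ℂ) : ℂ :=
  if h : ∃ φ : ℂ → ℂ, IsPhiContinuation a b c q φ then h.choose x else 0

/-! ### The `q`-hypergeometric Jacobi operator and its explicit solutions -/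

/-- `μ(y) = (y + y⁻¹)/2`. -/
def mu (y : ℂ) : ℂ := (y + y⁻¹) / 2

/-- `a_k = ½ √((1 - q^{-k}/r)(1 - c q^{-k}/(d²r)))`. -/
def coeffA (q r c d : ℝ) (k : ℤ) : ℝ :=
  1 / 2 * √((1 - q ^ (-k) / r) * (1 - c * q ^ (-k) / (d ^ 2 * r)))

/-- `b_k = q^{-k}(c+q)/(2dr)`. -/
def coeffB (q r c d : ℝ) (k : ℤ) : ℝ :=
  q ^ (-k) * (c + q) / (2 * d * r)

/-- The weight with `w_k² = d^{2k} (cq^{1-k}/(d²r);q)_∞ / (q^{1-k}/r;q)_∞`; the sign of `w_k` is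
that of `d^k`. -/
def weight (q r c d : ℝ) (k : ℤ) : ℝ :=
  d ^ k * √(qPochInf (c * q ^ (1 - k) / (d ^ 2 * r)) q / qPochInf (q ^ (1 - k) / r) q)

/-- `f_k(μ(y)) = ₂φ₁(dy, d/y; c; q, r q^k)`. -/
def solf (q r c d : ℝ) (y : ℂ) (k : ℤ) : ℂ :=
  twoPhiOne (d * y) (d / y) c q (r * (q : ℂ) ^ k)

/-- `g_k(μ(y)) = q^k c^{-k} ₂φ₁(qdy/c, qd/(cy); q²/c; q, r q^k)`. -/
def solg (q r c d : ℝ) (y : ℂ) (k : ℤ) : ℂ :=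
  (q : ℂ) ^ k * (c : ℂ) ^ (-k) *
    twoPhiOne (q * d * y / c) (q * d / (c * y)) ((q : ℂ) ^ 2 / c) q (r * (q : ℂ) ^ k)

/-- `F_k(y) = (dy)^{-k} ₂φ₁(dy, qdy/c; qy²; q, q^{1-k}c/(d²r))`. -/
def solF (q r c d : ℝ) (y : ℂ) (k : ℤ) : ℂ :=
  (d * y) ^ (-k) *
    twoPhiOne (d * y) (q * d * y / c) (q * y ^ 2) q ((q : ℂ) ^ (1 - k) * c / ((d : ℂ) ^ 2 * r))

/-- The sequence `w v`. -/
def weighted (q r c d : ℝ) (v : ℤ → ℂ) (k : ℤ) : ℂ := weight q r c d k * v k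

end DoublyInfiniteJacobi

end

open DoublyInfiniteJacobi

open scoped lp

noncomputable section

/-! The adjoint of `L` is the recurrence itself on its maximal domain in ℓ²(ℤ), so the deficiency
space at `z` is the intersection of S⁺_z and S⁻_z (`deficiencySpace_jacobiOperator_map`). Since no
`a_k` vanishes, the full solution space has dimension 2, and everything reduces to the behaviour of
solutions at the two ends.

Explicit solutions come from the second-order q-difference equation of ₂φ₁ (`phiSeries_qdiff`). It
follows from the ratio of consecutive coefficients, and it also continues the series to the cut
plane, because it expresses the value at x by those at qx and q²x. Conjugation by `w` removes the
square roots from the recurrence (`weighted_mem_solutions`), and what is left is this equation along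
a geometric progression of negative numbers. Since ₂φ₁ tends to 1 at 0, only the prefactors matter:
for n → ∞ the weight is of order c^{n/2}, so `wf` and `wg` are of order c^{n/2} and (q/√c)^n, while
at -n the sequence `wF` is O(|y|^n).

At minus infinity the `a_k` are bounded, so the Wronskian of two square summable solutions tends to
0. Being constant, it vanishes, and S⁻_z is the line through `wF`.

At plus infinity `a_n` grows like q^{-n}. If c ≤ q², then `a_n` times `wf` stays bounded, the
Wronskian of `wf` with any element of S⁺_z vanishes, and S⁺_z is a line. For an element of both
spaces the current a_k Im(u_{k+1} conj(u_k)) tends to 0 at both ends; its increments are Im z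
|u_k|², so the element is zero (`solution_eq_zero_of_current`). Von Neumann's criterion then gives
essential self-adjointness.

If q² < c < 1, both `wf` and `wg` are square summable at plus infinity, and for c ≠ q their
different rates make them a basis of all solutions. For c = q the two coincide, and reduction of
order (`solutions_le_solPlus_of_eq`) shows that every solution is at most of order n q^{n/2}. In
either case S⁺_z contains all solutions, so the deficiency spaces equal S⁻_z and have dimension 1.
-/

namespace DoublyInfiniteJacobi

open Complex Filter Topology

/-! ### Von Neumann's criterion for essential self-adjointness -/

section Criterion

open scoped ComplexConjugate InnerProductSpace
open LinearPMap

variable {H : Type*} [NormedAddCommGroup H] [InnerProductSpace ℂ H] [CompleteSpace H]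

theorem isClosable_of_isFormalAdjoint {T : H →ₗ.[ℂ] H} (hT : Dense (T.domain : Set H))
    (hsymm : T.IsFormalAdjoint T) : T.IsClosable :=
  (adjoint_isClosed hT).isClosable.leIsClosable (hsymm.le_adjoint hT)

/-- Membership in the graph of the adjoint is a family of closed linear conditions indexed by the
graph of `T`; such conditions persist on its closure. -/
theorem closure_adjoint_eq_adjoint {T : H →ₗ.[ℂ] H} (hT : Dense (T.domain : Set H))
    (hc : T.IsClosable) : T.closure.adjoint = T.adjoint := by
  have hT' : Dense (T.closure.domain : Set H) := hT.mono T.le_closure.1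
  apply eq_of_eq_graph
  rw [adjoint_graph_eq_graph_adjoint hT', adjoint_graph_eq_graph_adjoint hT,
    ← hc.graph_closure_eq_closure_graph]
  ext x
  rw [Submodule.mem_adjoint_iff, Submodule.mem_adjoint_iff]
  constructor
  · exact fun h a b hab => h a b (Submodule.le_topologicalClosure _ hab)
  · intro h a b hab
    have hclosed : IsClosed {p : H × H | inner ℂ p.2 x.1 - inner ℂ p.1 x.2 = 0} :=
      isClosed_eq (by fun_prop) continuous_const
    have hsub : (T.graph : Set (H × H)) ⊆ {p : H × H | inner ℂ p.2 x.1 - inner ℂ p.1 x.2 = 0} :=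
      fun p hp => h p.1 p.2 hp
    exact closure_minimal hsub hclosed hab

/-- Factor T*² + 1 = (T* + i)(T* - i): the vector (T* - i)v lies in N_{-i}, hence vanishes, and then
v lies in N_i. -/
theorem eq_zero_of_adjoint_adjoint_eq_neg {T : H →ₗ.[ℂ] H}
    (hI : deficiencySpace T I = ⊥) (hI' : deficiencySpace T (-I) = ⊥)
    (v : T.adjoint.domain) (hv : T.adjoint v ∈ T.adjoint.domain)
    (h : T.adjoint ⟨T.adjoint v, hv⟩ = -(v : H)) : (v : H) = 0 := by
  have key : T.adjoint v - I • (v : H) ∈ deficiencySpace T (-I) := by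
    refine ⟨Submodule.sub_mem _ hv (Submodule.smul_mem _ _ v.2), ?_⟩
    have h1 := T.adjoint.map_sub ⟨T.adjoint v, hv⟩ (I • v)
    rw [T.adjoint.map_smul, h] at h1
    refine h1.trans ?_
    rw [smul_sub, smul_smul]
    simp only [neg_mul, I_mul_I, neg_neg, one_smul, neg_smul]
    abel
  rw [hI', Submodule.mem_bot, sub_eq_zero] at key
  have : (v : H) ∈ deficiencySpace T I := ⟨v.2, key⟩
  rwa [hI, Submodule.mem_bot] at this

/-- The closure is a closed subspace of the graph of T*. A vector of that graph orthogonal to it has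
the form (v, T*v) with T*T*v = -v, so it is zero. -/
theorem adjoint_le_closure {T : H →ₗ.[ℂ] H} (hT : Dense (T.domain : Set H))
    (hsymm : T.IsFormalAdjoint T)
    (hI : deficiencySpace T I = ⊥) (hI' : deficiencySpace T (-I) = ⊥) :
    T.adjoint ≤ T.closure := by
  have hc := isClosable_of_isFormalAdjoint hT hsymm
  apply le_of_le_graph
  have hle : T.closure.graph ≤ T.adjoint.graph := by
    rw [← hc.graph_closure_eq_closure_graph]
    exact Submodule.topologicalClosure_minimal _ (le_graph_of_le (hsymm.le_adjoint hT))
      (adjoint_isClosed hT)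
  -- The sup norm on `H × H` carries no inner product; the orthogonal decomposition is made in the
  -- ℓ² product and transported by `e`.
  let e : WithLp 2 (H × H) ≃ₗ[ℂ] H × H := WithLp.linearEquiv 2 ℂ (H × H)
  let M : Submodule ℂ (WithLp 2 (H × H)) := T.closure.graph.comap e.toLinearMap
  have hM : IsClosed (M : Set (WithLp 2 (H × H))) :=
    hc.closure_isClosed.preimage (WithLp.prod_continuous_ofLp _ _ _)
  have : CompleteSpace M := hM.completeSpace_coe
  intro p hp
  obtain ⟨s, hs, t, ht, hst⟩ := Submodule.exists_add_mem_mem_orthogonal (K := M) (WithLp.toLp 2 p)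
  have hs' : e s ∈ T.closure.graph := hs
  have hpe : p = e s + e t := by
    have := congrArg e hst
    simpa [e] using this
  have ht' : e t ∈ T.adjoint.graph := by
    have : e t = p - e s := by rw [hpe]; abel
    rw [this]
    exact Submodule.sub_mem _ hp (hle hs')
  obtain ⟨v, hv1, hv2⟩ := (mem_graph_iff _).1 ht'
  -- Orthogonality to (x, Tx) reads ⟨v, x⟩ + ⟨T*v, Tx⟩ = 0, which says that T*v lies in the domain
  -- of T* and is mapped to -v.
  have horth : ∀ x : T.domain, inner ℂ (-(v : H)) (x : H) = inner ℂ (T.adjoint v) (T x) := by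
    intro x
    have hx : WithLp.toLp 2 ((x : H), T x) ∈ M :=
      le_graph_of_le T.le_closure (mem_graph T x)
    have h0 := (Submodule.mem_orthogonal' M t).1 ht _ hx
    rw [WithLp.prod_inner_apply] at h0
    have e1 : (WithLp.ofLp t).1 = v := hv1.symm
    have e2 : (WithLp.ofLp t).2 = T.adjoint v := hv2.symm
    rw [e1, e2] at h0
    rw [inner_neg_left]
    exact neg_eq_of_add_eq_zero_right h0
  have hdom : T.adjoint v ∈ T.adjoint.domain := mem_adjoint_domain_of_exists _ ⟨_, horth⟩
  have hv0 := eq_zero_of_adjoint_adjoint_eq_neg hI hI' v hdom (adjoint_apply_eq hT _ horth)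
  have hv0' : v = 0 := Subtype.ext hv0
  have het : e t = 0 := by
    ext
    · rw [← hv1, hv0]; rfl
    · rw [← hv2, hv0', T.adjoint.map_zero]; rfl
  rw [hpe, het, add_zero]
  exact hs'

theorem isEssentiallySelfAdjoint_of_deficiencySpace_eq_bot {T : H →ₗ.[ℂ] H}
    (hT : Dense (T.domain : Set H)) (hsymm : T.IsFormalAdjoint T)
    (hI : deficiencySpace T I = ⊥) (hI' : deficiencySpace T (-I) = ⊥) :
    IsEssentiallySelfAdjoint T := by
  have hc := isClosable_of_isFormalAdjoint hT hsymm
  refine ⟨hT, hsymm, hc, ?_⟩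
  rw [isSelfAdjoint_def, closure_adjoint_eq_adjoint hT hc]
  refine le_antisymm (adjoint_le_closure hT hsymm hI hI') ?_
  apply le_of_le_graph
  rw [← hc.graph_closure_eq_closure_graph]
  exact Submodule.topologicalClosure_minimal _ (le_graph_of_le (hsymm.le_adjoint hT))
    (adjoint_isClosed hT)

end Criterion

/-! ### The adjoint of the Jacobi operator -/

section JacobiAdjoint

open LinearPMap

variable (a b : ℤ → ℝ)

theorem jacobiAction_apply (v : ℤ → ℂ) (k : ℤ) :
    jacobiAction a b v k = a k * v (k + 1) + b k * v k + a (k - 1) * v (k - 1) := rfl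

theorem dense_finiteSequences : Dense (finiteSequences : Set ℓ²(ℤ, ℂ)) := by
  intro v
  have h := lp.hasSum_single (p := 2) (by simp) v
  refine mem_closure_of_tendsto h (Eventually.of_forall fun s => ?_)
  refine Submodule.sum_mem _ fun k _ => ?_
  rw [finiteSequences_eq_span]
  have : (lp.single 2 k (v k) : ℓ²(ℤ, ℂ)) = v k • lp.single 2 k (1 : ℂ) := by
    rw [← lp.single_smul, smul_eq_mul, mul_one]
  rw [this]
  exact Submodule.smul_mem _ _ (Submodule.subset_span ⟨k, rfl⟩)

theorem single_mem_finiteSequences (k : ℤ) :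
    (lp.single 2 k (1 : ℂ) : ℓ²(ℤ, ℂ)) ∈ finiteSequences := by
  rw [finiteSequences_eq_span]
  exact Submodule.subset_span ⟨k, rfl⟩

theorem jacobiOperator_single (k : ℤ) :
    jacobiOperator a b ⟨lp.single 2 k (1 : ℂ), single_mem_finiteSequences k⟩ =
      (a k : ℂ) • lp.single 2 (k + 1) (1 : ℂ) + (b k : ℂ) • lp.single 2 k (1 : ℂ) +
        (a (k - 1) : ℂ) • lp.single 2 (k - 1) (1 : ℂ) := by
  ext l
  change jacobiAction a b (lp.single 2 k (1 : ℂ) : ℓ²(ℤ, ℂ)) l = _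
  rw [jacobiAction_apply]
  simp only [lp.coeFn_add, lp.coeFn_smul, Pi.add_apply, Pi.smul_apply, lp.single_apply,
    Pi.single_apply, smul_eq_mul]
  by_cases h1 : l = k + 1
  · subst h1
    simp
    have : k + 1 + 1 ≠ k := by omega
    have h' : k + 1 ≠ k - 1 := by omega
    simp [this, h']
  by_cases h2 : l = k
  · subst h2
    have : l ≠ l - 1 := by omega
    simp [this]
  by_cases h3 : l = k - 1
  · subst h3
    simp
    have : k - 1 - 1 ≠ k := by omega
    simp [this, h1]
  have h4 : l + 1 ≠ k := by omega
  have h5 : l - 1 ≠ k := by omega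
  simp [h1, h2, h3, h4, h5]

theorem inner_jacobiOperator_single (v : ℓ²(ℤ, ℂ)) (k : ℤ) :
    inner ℂ v (jacobiOperator a b ⟨lp.single 2 k (1 : ℂ), single_mem_finiteSequences k⟩) =
      starRingEnd ℂ (jacobiAction a b v k) := by
  rw [jacobiOperator_single, inner_add_right, inner_add_right, inner_smul_right, inner_smul_right,
    inner_smul_right, lp.inner_single_right, lp.inner_single_right, lp.inner_single_right,
    jacobiAction_apply]
  simp

theorem inner_eq_inner_jacobiOperator {v w : ℓ²(ℤ, ℂ)}
    (h : (w : ℤ → ℂ) = jacobiAction a b v) (x : (jacobiOperator a b).domain) :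
    inner ℂ w (x : ℓ²(ℤ, ℂ)) = inner ℂ v (jacobiOperator a b x) := by
  obtain ⟨x, hx⟩ := x
  have hx' : x ∈ finiteSequences := hx
  have hspan := hx'
  rw [finiteSequences_eq_span] at hspan
  induction hspan using Submodule.span_induction with
  | mem y hy =>
    obtain ⟨k, rfl⟩ := hy
    rw [inner_jacobiOperator_single, lp.inner_single_right, h]
    simp
  | zero =>
    have : jacobiOperator a b ⟨0, hx⟩ = 0 := (jacobiOperator a b).map_zero
    rw [this, inner_zero_right, inner_zero_right]
  | add y z hy hz ihy ihz =>
    rw [← finiteSequences_eq_span] at hy hz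
    have : jacobiOperator a b ⟨y + z, hx⟩ =
        jacobiOperator a b ⟨y, hy⟩ + jacobiOperator a b ⟨z, hz⟩ :=
      (jacobiOperator a b).map_add ⟨y, hy⟩ ⟨z, hz⟩
    rw [this, inner_add_right, inner_add_right, ← ihy hy hy, ← ihz hz hz]
  | smul s y hy ihy =>
    rw [← finiteSequences_eq_span] at hy
    have : jacobiOperator a b ⟨s • y, hx⟩ = s • jacobiOperator a b ⟨y, hy⟩ :=
      (jacobiOperator a b).map_smul s ⟨y, hy⟩
    rw [this, inner_smul_right, inner_smul_right, ← ihy hy hy]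

theorem dense_domain_jacobiOperator : Dense ((jacobiOperator a b).domain : Set ℓ²(ℤ, ℂ)) :=
  dense_finiteSequences

theorem jacobiOperator_isFormalAdjoint :
    (jacobiOperator a b).IsFormalAdjoint (jacobiOperator a b) :=
  fun x y => inner_eq_inner_jacobiOperator a b
    (v := (x : ℓ²(ℤ, ℂ))) (w := jacobiOperator a b x) rfl y

/-- Testing the adjoint relation on each `e_k` recovers the recurrence. No domain condition appears:
for an ℓ² solution, L*v = zv is automatically in ℓ². -/
theorem mem_deficiencySpace_jacobiOperator {z : ℂ} {v : ℓ²(ℤ, ℂ)} :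
    v ∈ deficiencySpace (jacobiOperator a b) z ↔ jacobiAction a b v = z • (v : ℤ → ℂ) := by
  have hd := dense_domain_jacobiOperator a b
  constructor
  · rintro ⟨hv, h⟩
    ext k
    have h1 := adjoint_isFormalAdjoint hd ⟨v, hv⟩
      ⟨lp.single 2 k (1 : ℂ), single_mem_finiteSequences k⟩
    rw [h, inner_jacobiOperator_single, lp.inner_single_right] at h1
    simp only [lp.coeFn_smul, RCLike.inner_apply, one_mul] at h1
    exact ((starRingEnd ℂ).injective h1).symm
  · intro h
    have h1 : ∀ x : (jacobiOperator a b).domain,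
        inner ℂ (z • v) (x : ℓ²(ℤ, ℂ)) = inner ℂ v (jacobiOperator a b x) :=
      inner_eq_inner_jacobiOperator a b (by rw [h, lp.coeFn_smul])
    exact ⟨mem_adjoint_domain_of_exists _ ⟨_, h1⟩, adjoint_apply_eq hd _ h1⟩

end JacobiAdjoint

/-! ### Solutions of the recurrence, Wronskian and current -/

section Solutions

variable {a b : ℤ → ℝ} {z : ℂ}

/-- All sequences with `L* u = z u`. -/
def solutions (a b : ℤ → ℝ) (z : ℂ) : Submodule ℂ (ℤ → ℂ) :=
  LinearMap.eqLocus (jacobiAction a b) (z • LinearMap.id)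

theorem mem_solutions {u : ℤ → ℂ} : u ∈ solutions a b z ↔ jacobiAction a b u = z • u := Iff.rfl

theorem mem_solutions_iff {u : ℤ → ℂ} : u ∈ solutions a b z ↔
    ∀ k, a k * u (k + 1) + b k * u k + a (k - 1) * u (k - 1) = z * u k := by
  rw [mem_solutions, funext_iff]
  rfl

theorem solMinus_le_solutions : solMinus a b z ≤ solutions a b z := fun _ h => h.1

theorem solPlus_le_solutions : solPlus a b z ≤ solutions a b z := fun _ h => h.1

theorem solution_eq_zero_of_consecutive (ha : ∀ k, a k ≠ 0) {u : ℤ → ℂ}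
    (hu : u ∈ solutions a b z) {k : ℤ} (h0 : u k = 0) (h1 : u (k + 1) = 0) : u = 0 := by
  rw [mem_solutions_iff] at hu
  have ha' : ∀ k, (a k : ℂ) ≠ 0 := fun k => ofReal_ne_zero.2 (ha k)
  have up : ∀ n : ℕ, u (k + n) = 0 ∧ u (k + n + 1) = 0 := by
    intro n
    induction n with
    | zero => simpa using ⟨h0, h1⟩
    | succ n ih =>
      have h := hu (k + n + 1)
      rw [ih.2, add_sub_cancel_right, ih.1] at h
      have h' : u (k + n + 1 + 1) = 0 := by simpa [ha'] using h
      push_cast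
      rw [← add_assoc]
      exact ⟨ih.2, h'⟩
  have down : ∀ n : ℕ, u (k - n) = 0 ∧ u (k - n + 1) = 0 := by
    intro n
    induction n with
    | zero => simpa using ⟨h0, h1⟩
    | succ n ih =>
      have h := hu (k - n)
      rw [ih.2, ih.1] at h
      have h' : u (k - n - 1) = 0 := by simpa [ha'] using h
      push_cast
      rw [show k - ((n : ℤ) + 1) = k - n - 1 by ring, sub_add_cancel]
      exact ⟨h', ih.1⟩
  ext l
  rcases le_total k l with h | h
  · obtain ⟨n, rfl⟩ := Int.le.dest h
    exact (up n).1
  · obtain ⟨n, hn⟩ := Int.le.dest h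
    have : l = k - n := by omega
    rw [this]
    exact (down n).1

/-- The initial values `(u_0, u_1)` of a solution. -/
def initialValues (a b : ℤ → ℝ) (z : ℂ) : solutions a b z →ₗ[ℂ] ℂ × ℂ :=
  ((LinearMap.proj 0).prod (LinearMap.proj 1)).comp (solutions a b z).subtype

theorem initialValues_apply (u : solutions a b z) :
    initialValues a b z u = ((u : ℤ → ℂ) 0, (u : ℤ → ℂ) 1) := rfl

theorem initialValues_injective (ha : ∀ k, a k ≠ 0) :
    Function.Injective (initialValues a b z) := by
  rw [← LinearMap.ker_eq_bot, LinearMap.ker_eq_bot']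
  intro u hu
  rw [initialValues_apply, Prod.mk_eq_zero] at hu
  exact Subtype.ext (solution_eq_zero_of_consecutive ha u.2 hu.1 (by simpa using hu.2))

/-- The forward recursion for `(u_n, u_{n+1})`. -/
def forwardPair (a b : ℤ → ℝ) (z : ℂ) (p : ℂ × ℂ) : ℕ → ℂ × ℂ
  | 0 => p
  | n + 1 => ((forwardPair a b z p n).2,
      ((z - b (n + 1)) * (forwardPair a b z p n).2 - a n * (forwardPair a b z p n).1) / a (n + 1))

/-- The backward recursion for `(u_{-n}, u_{-n+1})`. -/
def backwardPair (a b : ℤ → ℝ) (z : ℂ) (p : ℂ × ℂ) : ℕ → ℂ × ℂ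
  | 0 => p
  | n + 1 => (((z - b (-n)) * (backwardPair a b z p n).1 -
      a (-n) * (backwardPair a b z p n).2) / a (-n - 1), (backwardPair a b z p n).1)

/-- The solution with initial values `(u_0, u_1) = p`. -/
def solutionOf (a b : ℤ → ℝ) (z : ℂ) (p : ℂ × ℂ) (k : ℤ) : ℂ :=
  if 0 ≤ k then (forwardPair a b z p k.toNat).1 else (backwardPair a b z p (-k).toNat).1

theorem solutionOf_natCast (p : ℂ × ℂ) (n : ℕ) :
    solutionOf a b z p n = (forwardPair a b z p n).1 := by
  simp [solutionOf]

theorem solutionOf_neg_natCast (p : ℂ × ℂ) (n : ℕ) :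
    solutionOf a b z p (-n) = (backwardPair a b z p n).1 := by
  rcases n with _ | n
  · simp [solutionOf, forwardPair, backwardPair]
  · have : ¬ (0 : ℤ) ≤ -((n + 1 : ℕ) : ℤ) := by omega
    rw [solutionOf, if_neg this]
    simp

theorem solutionOf_one_sub_natCast (p : ℂ × ℂ) (n : ℕ) :
    solutionOf a b z p (-n + 1) = (backwardPair a b z p n).2 := by
  rcases n with _ | n
  · have := solutionOf_natCast (a := a) (b := b) (z := z) p 1
    simpa [forwardPair, backwardPair] using this
  · have : -((n + 1 : ℕ) : ℤ) + 1 = -(n : ℤ) := by push_cast; ring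
    rw [this, solutionOf_neg_natCast]
    rfl

theorem solutionOf_mem (ha : ∀ k, a k ≠ 0) (p : ℂ × ℂ) :
    solutionOf a b z p ∈ solutions a b z := by
  rw [mem_solutions_iff]
  have ha' : ∀ k, (a k : ℂ) ≠ 0 := fun k => ofReal_ne_zero.2 (ha k)
  intro k
  rcases lt_or_ge 0 k with hk | hk
  · obtain ⟨n, rfl⟩ : ∃ n : ℕ, k = n + 1 := ⟨(k - 1).toNat, by omega⟩
    have e1 : solutionOf a b z p ((n : ℤ) + 1) = (forwardPair a b z p n).2 := by
      have := solutionOf_natCast (a := a) (b := b) (z := z) p (n + 1)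
      push_cast at this
      rw [this, forwardPair]
    have e2 : solutionOf a b z p ((n : ℤ) + 1 + 1) = (forwardPair a b z p (n + 1)).2 := by
      have := solutionOf_natCast (a := a) (b := b) (z := z) p (n + 1 + 1)
      push_cast at this
      rw [this, forwardPair]
    rw [add_sub_cancel_right, e1, e2, solutionOf_natCast, forwardPair]
    have := ha' (n + 1)
    field_simp
    ring
  · obtain ⟨n, rfl⟩ : ∃ n : ℕ, k = -n := ⟨(-k).toNat, by omega⟩
    have e1 : solutionOf a b z p (-(n : ℤ) - 1) = (backwardPair a b z p (n + 1)).1 := by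
      have := solutionOf_neg_natCast (a := a) (b := b) (z := z) p (n + 1)
      rw [← this]
      congr 1
      push_cast
      ring
    rw [solutionOf_one_sub_natCast, solutionOf_neg_natCast, e1, backwardPair]
    have := ha' (-n - 1)
    field_simp
    ring

theorem initialValues_surjective (ha : ∀ k, a k ≠ 0) :
    Function.Surjective (initialValues a b z) := by
  intro p
  refine ⟨⟨solutionOf a b z p, solutionOf_mem ha p⟩, ?_⟩
  rw [initialValues_apply]
  have h0 := solutionOf_neg_natCast (a := a) (b := b) (z := z) p 0
  have h1 := solutionOf_one_sub_natCast (a := a) (b := b) (z := z) p 0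
  simp only [Nat.cast_zero, neg_zero, zero_add, backwardPair] at h0 h1
  simp only [h0, h1]

/-- Solutions are parametrised by their initial values. -/
def solutionsEquiv (b : ℤ → ℝ) (z : ℂ) (ha : ∀ k, a k ≠ 0) : solutions a b z ≃ₗ[ℂ] ℂ × ℂ :=
  LinearEquiv.ofBijective (initialValues a b z)
    ⟨initialValues_injective ha, initialValues_surjective ha⟩

theorem finrank_solutions (ha : ∀ k, a k ≠ 0) : Module.finrank ℂ (solutions a b z) = 2 := by
  rw [(solutionsEquiv b z ha).finrank_eq, Module.finrank_prod, Module.finrank_self]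

theorem finiteDimensional_solutions (ha : ∀ k, a k ≠ 0) :
    FiniteDimensional ℂ (solutions a b z) :=
  (solutionsEquiv b z ha).symm.finiteDimensional

/-- The Wronskian (Casorati determinant) of two sequences. -/
def wronskian (a : ℤ → ℝ) (u v : ℤ → ℂ) (k : ℤ) : ℂ := a k * (u (k + 1) * v k - u k * v (k + 1))

theorem wronskian_sub_one {u v : ℤ → ℂ} (hu : u ∈ solutions a b z) (hv : v ∈ solutions a b z)
    (k : ℤ) : wronskian a u v (k - 1) = wronskian a u v k := by
  rw [mem_solutions_iff] at hu hv
  rw [wronskian, wronskian, sub_add_cancel]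
  linear_combination u k * hv k - v k * hu k

theorem wronskian_eq {u v : ℤ → ℂ} (hu : u ∈ solutions a b z) (hv : v ∈ solutions a b z)
    (k : ℤ) : wronskian a u v k = wronskian a u v 0 := by
  induction k using Int.induction_on with
  | zero => rfl
  | succ n ih => rw [← ih, ← wronskian_sub_one hu hv, add_sub_cancel_right]
  | pred n ih => rw [wronskian_sub_one hu hv, ih]

theorem mem_span_of_wronskian_eq_zero (ha : ∀ k, a k ≠ 0) {u v : ℤ → ℂ}
    (hu : u ∈ solutions a b z) (hv : v ∈ solutions a b z) (hv0 : v ≠ 0)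
    (h : wronskian a u v 0 = 0) : u ∈ Submodule.span ℂ {v} := by
  rw [wronskian, mul_eq_zero, ofReal_eq_zero, or_iff_right (ha 0), zero_add] at h
  obtain ⟨s, hs0, hs1⟩ : ∃ s : ℂ, u 0 = s * v 0 ∧ u 1 = s * v 1 := by
    by_cases h0 : v 0 = 0
    · have h1 : v 1 ≠ 0 := fun h1 =>
        hv0 (solution_eq_zero_of_consecutive ha hv h0 (by simpa using h1))
      refine ⟨u 1 / v 1, ?_, ?_⟩
      · rw [h0, mul_zero, zero_sub, neg_eq_zero, mul_eq_zero, or_iff_left h1] at h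
        rw [h0, h, mul_zero]
      · field_simp
    · refine ⟨u 0 / v 0, by field_simp, ?_⟩
      field_simp
      linear_combination h
  have hmem : u - s • v ∈ solutions a b z :=
    Submodule.sub_mem _ hu (Submodule.smul_mem _ s hv)
  have := solution_eq_zero_of_consecutive ha hmem (k := 0) (by simp [hs0]) (by simp [hs1])
  rw [Submodule.mem_span_singleton]
  exact ⟨s, (sub_eq_zero.1 this).symm⟩

theorem finrank_and_eq_span_of_wronskian (ha : ∀ k, a k ≠ 0) {S : Submodule ℂ (ℤ → ℂ)}
    (hS : S ≤ solutions a b z) {v : ℤ → ℂ} (hv : v ∈ S) (hv0 : v ≠ 0)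
    (h : ∀ u ∈ S, wronskian a u v 0 = 0) :
    Module.finrank ℂ S = 1 ∧ S = Submodule.span ℂ {v} := by
  have hspan : S = Submodule.span ℂ {v} := by
    apply le_antisymm
    · exact fun u hu => mem_span_of_wronskian_eq_zero ha (hS hu) (hS hv) hv0 (h u hu)
    · rw [Submodule.span_singleton_le_iff_mem]
      exact hv
  refine ⟨?_, hspan⟩
  rw [hspan]
  exact finrank_span_singleton hv0

theorem tendsto_zero_of_summable_norm_sq {u : ℕ → ℂ} (hu : Summable fun n => ‖u n‖ ^ 2) :
    Tendsto (fun n => ‖u n‖) atTop (𝓝 0) := by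
  have h := (Real.continuous_sqrt.tendsto 0).comp hu.tendsto_atTop_zero
  rw [Real.sqrt_zero] at h
  refine h.congr fun n => ?_
  simp [Real.sqrt_sq (norm_nonneg _)]

theorem norm_wronskian_le (u v : ℤ → ℂ) (k : ℤ) :
    ‖wronskian a u v k‖ ≤ |a k| * (‖u (k + 1)‖ * ‖v k‖ + ‖u k‖ * ‖v (k + 1)‖) := by
  rw [wronskian, norm_mul, norm_real, Real.norm_eq_abs]
  gcongr
  exact (norm_sub_le _ _).trans (by rw [norm_mul, norm_mul])

theorem tendsto_norm_of_mem_solMinus {u : ℤ → ℂ} (hu : u ∈ solMinus a b z) :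
    Tendsto (fun n : ℕ => ‖u (-(n : ℤ) - 1)‖) atTop (𝓝 0) :=
  tendsto_zero_of_summable_norm_sq hu.2

theorem tendsto_norm_of_mem_solPlus {u : ℤ → ℂ} (hu : u ∈ solPlus a b z) :
    Tendsto (fun n : ℕ => ‖u n‖) atTop (𝓝 0) :=
  tendsto_zero_of_summable_norm_sq (u := fun n : ℕ => u n) hu.2

/-- The index -n-2 makes both entries of the Wronskian, at -n-2 and -n-1, lie in the range k ≤ -1
where summability is known. -/
theorem tendsto_wronskian_neg {A : ℝ} (hA : ∀ k < 0, |a k| ≤ A) {u v : ℤ → ℂ}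
    (hu : Tendsto (fun n : ℕ => ‖u (-(n : ℤ) - 1)‖) atTop (𝓝 0))
    (hv : Tendsto (fun n : ℕ => ‖v (-(n : ℤ) - 1)‖) atTop (𝓝 0)) :
    Tendsto (fun n : ℕ => wronskian a u v (-(n : ℤ) - 2)) atTop (𝓝 0) := by
  have hu' := hu.comp (tendsto_add_atTop_nat 1)
  have hv' := hv.comp (tendsto_add_atTop_nat 1)
  have hlim := ((hu.mul hv').add (hu'.mul hv)).const_mul A
  rw [mul_zero, add_zero, mul_zero] at hlim
  refine squeeze_zero_norm (fun n => ?_) hlim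
  have e1 : -(n : ℤ) - 2 + 1 = -(n : ℤ) - 1 := by ring
  have e2 : -((n + 1 : ℕ) : ℤ) - 1 = -(n : ℤ) - 2 := by push_cast; ring
  refine (norm_wronskian_le u v _).trans ?_
  simp only [Function.comp, e1, e2]
  gcongr
  exact hA _ (by omega)

theorem wronskian_eq_zero_of_mem_solMinus {A : ℝ} (hA : ∀ k < 0, |a k| ≤ A) {u v : ℤ → ℂ}
    (hu : u ∈ solMinus a b z) (hv : v ∈ solMinus a b z) : wronskian a u v 0 = 0 := by
  have h := tendsto_wronskian_neg hA (tendsto_norm_of_mem_solMinus hu)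
    (tendsto_norm_of_mem_solMinus hv)
  simp_rw [wronskian_eq (solMinus_le_solutions hu) (solMinus_le_solutions hv)] at h
  exact tendsto_nhds_unique tendsto_const_nhds h

/-- This serves at plus infinity, where `a` is unbounded: decay of `v` compensates for the growth of
`a`, and `u` tends to 0. `v` itself need not be assumed square summable. -/
theorem wronskian_eq_zero_of_bounded {A : ℝ} {u v : ℤ → ℂ}
    (hu : u ∈ solPlus a b z) (hv : v ∈ solutions a b z)
    (hA : ∀ n : ℕ, |a n| * ‖v n‖ ≤ A ∧ |a n| * ‖v (n + 1)‖ ≤ A) : wronskian a u v 0 = 0 := by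
  have hu' := tendsto_norm_of_mem_solPlus hu
  have hlim := ((hu'.comp (tendsto_add_atTop_nat 1)).const_mul A).add (hu'.const_mul A)
  rw [mul_zero, add_zero] at hlim
  have h : Tendsto (fun n : ℕ => wronskian a u v n) atTop (𝓝 0) := by
    refine squeeze_zero_norm (fun n => ?_) hlim
    refine (norm_wronskian_le u v _).trans ?_
    simp only [Function.comp]
    push_cast
    have h1 := mul_le_mul_of_nonneg_right (hA n).1 (norm_nonneg (u (n + 1)))
    have h2 := mul_le_mul_of_nonneg_right (hA n).2 (norm_nonneg (u n))
    linarith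
  simp_rw [wronskian_eq (solPlus_le_solutions hu) hv] at h
  exact tendsto_nhds_unique tendsto_const_nhds h

/-- `a_k Im(u_{k+1} conj(u_k))`. -/
def currentIm (a : ℤ → ℝ) (u : ℤ → ℂ) (k : ℤ) : ℝ :=
  a k * (u (k + 1) * starRingEnd ℂ (u k)).im

/-- Multiply the recurrence at k by conj(u_k) and take imaginary parts; the diagonal term drops out
because `b` is real. -/
theorem currentIm_sub {u : ℤ → ℂ} (hu : u ∈ solutions a b z) (k : ℤ) :
    currentIm a u k - currentIm a u (k - 1) = z.im * ‖u k‖ ^ 2 := by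
  rw [mem_solutions_iff] at hu
  have h := congrArg Complex.im (congrArg (· * starRingEnd ℂ (u k)) (hu k))
  rw [currentIm, currentIm, sub_add_cancel, ← normSq_eq_norm_sq, normSq_apply]
  simp only [mul_im, add_im, add_re, mul_re, ofReal_re, ofReal_im, conj_re, conj_im] at h ⊢
  linear_combination h

theorem abs_currentIm_le (u : ℤ → ℂ) (k : ℤ) :
    |currentIm a u k| ≤ |a k| * (‖u (k + 1)‖ * ‖u k‖) := by
  rw [currentIm, abs_mul]
  gcongr
  refine (abs_im_le_norm _).trans ?_
  rw [norm_mul, norm_conj]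

/-- A solution for a nonreal spectral parameter whose current vanishes at both ends is zero. -/
theorem solution_eq_zero_of_current (hz : z.im ≠ 0) {u : ℤ → ℂ} (hu : u ∈ solutions a b z)
    (hneg : Tendsto (fun n : ℕ => currentIm a u (-(n : ℤ) - 2)) atTop (𝓝 0))
    (hpos : Tendsto (fun n : ℕ => currentIm a u n) atTop (𝓝 0)) : u = 0 := by
  -- Division by Im z makes the increments nonnegative whatever the sign of Im z; a monotone
  -- function with limit 0 at both ends vanishes.
  set h : ℤ → ℝ := fun k => currentIm a u k / z.im with hh
  have hstep : ∀ k, h k - h (k - 1) = ‖u k‖ ^ 2 := by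
    intro k
    simp only [hh, ← sub_div, currentIm_sub hu]
    field_simp
  have hmono : Monotone h := by
    refine monotone_int_of_le_succ fun k => ?_
    have := hstep (k + 1)
    rw [add_sub_cancel_right] at this
    nlinarith [sq_nonneg ‖u (k + 1)‖]
  have hneg' : Tendsto (fun n : ℕ => h (-(n : ℤ) - 2)) atTop (𝓝 0) := by
    simpa [hh] using hneg.div_const z.im
  have hpos' : Tendsto (fun n : ℕ => h n) atTop (𝓝 0) := by
    simpa [hh] using hpos.div_const z.im
  have hzero : ∀ k, h k = 0 := by
    intro k
    apply le_antisymm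
    · refine ge_of_tendsto hpos' ?_
      filter_upwards [eventually_ge_atTop k.toNat] with n hn
      exact hmono (by omega)
    · refine le_of_tendsto hneg' ?_
      filter_upwards [eventually_ge_atTop (-k).toNat] with n hn
      exact hmono (by omega)
  ext k
  have := hstep k
  rw [hzero, hzero, sub_zero] at this
  simpa using this.symm

end Solutions

/-! ### Deficiency spaces as intersections of S⁺ and S⁻ -/

section SquareSummable

variable {a b : ℤ → ℝ} {z : ℂ}

theorem memℓp_two_iff {u : ℤ → ℂ} : Memℓp u 2 ↔
    (Summable fun n : ℕ => ‖u n‖ ^ 2) ∧ Summable fun n : ℕ => ‖u (-(n : ℤ) - 1)‖ ^ 2 := by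
  rw [memℓp_gen_iff (by norm_num)]
  simp only [ENNReal.toReal_ofNat, Real.rpow_ofNat]
  constructor
  · intro h
    exact ⟨h.comp_injective (i := fun n : ℕ => (n : ℤ)) Nat.cast_injective,
      h.comp_injective (i := fun n : ℕ => -(n : ℤ) - 1) (fun m n hmn => by simpa using hmn)⟩
  · rintro ⟨h1, h2⟩
    refine Summable.of_nat_of_neg_add_one h1 (h2.congr fun n => ?_)
    rw [show -(n : ℤ) - 1 = -((n : ℤ) + 1) by ring]

/-- The inclusion of `ℓ²(ℤ)` into the space of all sequences. -/
def coeFnLinearMap : ℓ²(ℤ, ℂ) →ₗ[ℂ] ℤ → ℂ where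
  toFun v := v
  map_add' := lp.coeFn_add
  map_smul' := lp.coeFn_smul

theorem deficiencySpace_jacobiOperator_map (a b : ℤ → ℝ) (z : ℂ) :
    (deficiencySpace (jacobiOperator a b) z).map coeFnLinearMap =
      solPlus a b z ⊓ solMinus a b z := by
  ext u
  rw [Submodule.mem_map, Submodule.mem_inf]
  constructor
  · rintro ⟨v, hv, rfl⟩
    rw [mem_deficiencySpace_jacobiOperator] at hv
    have := memℓp_two_iff.1 (lp.memℓp v)
    exact ⟨⟨hv, this.1⟩, hv, this.2⟩
  · rintro ⟨h1, h2⟩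
    refine ⟨⟨u, memℓp_two_iff.2 ⟨h1.2, h2.2⟩⟩,
      (mem_deficiencySpace_jacobiOperator a b).2 h1.1, rfl⟩

/-- Deficiency spaces consist of the solutions that are square summable at both ends. -/
def deficiencySpaceEquiv (a b : ℤ → ℝ) (z : ℂ) :
    deficiencySpace (jacobiOperator a b) z ≃ₗ[ℂ] ↥(solPlus a b z ⊓ solMinus a b z) :=
  (Submodule.equivMapOfInjective coeFnLinearMap
    (fun _ _ h => lp.ext h) _).trans
    (LinearEquiv.ofEq _ _ (deficiencySpace_jacobiOperator_map a b z))

end SquareSummable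

/-! ### The cut plane -/

section CutPlane

theorem isOpen_cutPlane : IsOpen cutPlane :=
  (isometry_ofReal.isClosedEmbedding.isClosedMap _ isClosed_Ici).isOpen_compl

theorem one_notMem_cutPlane : (1 : ℂ) ∉ cutPlane := fun h => h ⟨1, by simp, by simp⟩

theorem ofReal_mem_cutPlane {t : ℝ} (ht : t < 1) : (t : ℂ) ∈ cutPlane := by
  rintro ⟨s, hs, h⟩
  rw [ofReal_inj] at h
  subst h
  exact absurd ht (not_lt.2 hs)

theorem ofReal_mul_mem_cutPlane {q : ℝ} (hq0 : 0 < q) (hq1 : q < 1) {x : ℂ} (hx : x ∈ cutPlane) :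
    q * x ∈ cutPlane := by
  rintro ⟨s, hs, h⟩
  apply hx
  refine ⟨s / q, ?_, ?_⟩
  · rw [Set.mem_Ici, le_div_iff₀ hq0]
    have : (1 : ℝ) ≤ s := hs
    linarith
  · have : (q : ℂ) ≠ 0 := ofReal_ne_zero.2 hq0.ne'
    rw [ofReal_div, h]
    field_simp

end CutPlane

/-! ### The ₂φ₁-series and its q-difference equation -/

section Series

variable {a b c : ℂ} {q : ℝ}

/-- The coefficients of the `₂φ₁`-series. -/
def phiCoeff (a b c q : ℂ) (k : ℕ) : ℂ :=
  qPoch a q k * qPoch b q k / (qPoch q q k * qPoch c q k)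

theorem qPoch_succ {R : Type*} [CommRing R] (a q : R) (k : ℕ) :
    qPoch a q (k + 1) = qPoch a q k * (1 - a * q ^ k) :=
  Finset.prod_range_succ _ _

theorem one_sub_mul_pow_ne_zero (hq0 : 0 < q) (hq1 : q < 1) (hc : ‖c‖ < 1) (k : ℕ) :
    1 - c * (q : ℂ) ^ k ≠ 0 := by
  intro h
  have h1 : ‖c * (q : ℂ) ^ k‖ < 1 := by
    rw [norm_mul, norm_pow, norm_real, Real.norm_of_nonneg hq0.le]
    have := pow_le_one₀ (n := k) hq0.le hq1.le
    nlinarith [norm_nonneg c, pow_pos hq0 k]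
  rw [← sub_eq_zero.1 h, norm_one] at h1
  exact lt_irrefl _ h1

theorem norm_ofReal_lt_one (hq0 : 0 < q) (hq1 : q < 1) : ‖(q : ℂ)‖ < 1 := by
  rwa [norm_real, Real.norm_of_nonneg hq0.le]

theorem qPoch_ne_zero (hq0 : 0 < q) (hq1 : q < 1) (hc : ‖c‖ < 1) (k : ℕ) :
    qPoch c (q : ℂ) k ≠ 0 :=
  Finset.prod_ne_zero_iff.2 fun i _ => one_sub_mul_pow_ne_zero hq0 hq1 hc i

theorem phiCoeff_succ (hq0 : 0 < q) (hq1 : q < 1) (hc : ‖c‖ < 1) (k : ℕ) :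
    phiCoeff a b c q (k + 1) * ((1 - (q : ℂ) ^ (k + 1)) * (1 - c * (q : ℂ) ^ k)) =
      phiCoeff a b c q k * ((1 - a * (q : ℂ) ^ k) * (1 - b * (q : ℂ) ^ k)) := by
  have hq := norm_ofReal_lt_one hq0 hq1
  have h1 := qPoch_ne_zero hq0 hq1 hq k
  have h2 := qPoch_ne_zero hq0 hq1 hc k
  have h3 := one_sub_mul_pow_ne_zero hq0 hq1 hq k
  have h4 := one_sub_mul_pow_ne_zero hq0 hq1 hc k
  rw [phiCoeff, phiCoeff, qPoch_succ, qPoch_succ, qPoch_succ, qPoch_succ, pow_succ' (q : ℂ) k]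
  rw [div_mul_eq_mul_div, div_mul_eq_mul_div,
    div_eq_div_iff (mul_ne_zero (mul_ne_zero h1 h3) (mul_ne_zero h2 h4)) (mul_ne_zero h1 h2)]
  ring

theorem summable_phiCoeff_mul_pow (hq0 : 0 < q) (hq1 : q < 1) (hc : ‖c‖ < 1) {x : ℂ}
    (hx : ‖x‖ < 1) : Summable fun k => phiCoeff a b c q k * x ^ k := by
  have hq := norm_ofReal_lt_one hq0 hq1
  have hpow : Tendsto (fun k : ℕ => (q : ℂ) ^ k) atTop (𝓝 0) :=
    tendsto_pow_atTop_nhds_zero_of_norm_lt_one hq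
  have hlim (e : ℂ) : Tendsto (fun k : ℕ => 1 - e * (q : ℂ) ^ k) atTop (𝓝 1) := by
    simpa using (hpow.const_mul e).const_sub 1
  have hratio : Tendsto (fun k : ℕ => (1 - a * (q : ℂ) ^ k) * (1 - b * (q : ℂ) ^ k) /
      ((1 - q * (q : ℂ) ^ k) * (1 - c * (q : ℂ) ^ k)) * x) atTop (𝓝 x) := by
    have := ((((hlim a).mul (hlim b)).div ((hlim q).mul (hlim c)) (by norm_num)).mul_const x)
    simpa using this
  obtain ⟨s, hs1, hs2⟩ := exists_between hx
  refine summable_of_ratio_norm_eventually_le hs2 ?_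
  filter_upwards [hratio.norm.eventually_lt_const hs1] with k hk
  have h3 := one_sub_mul_pow_ne_zero hq0 hq1 hq k
  have h4 := one_sub_mul_pow_ne_zero hq0 hq1 hc k
  have hrec : phiCoeff a b c q (k + 1) * x ^ (k + 1) =
      ((1 - a * (q : ℂ) ^ k) * (1 - b * (q : ℂ) ^ k) /
      ((1 - q * (q : ℂ) ^ k) * (1 - c * (q : ℂ) ^ k)) * x) * (phiCoeff a b c q k * x ^ k) := by
    have h := phiCoeff_succ (a := a) (b := b) hq0 hq1 hc k
    rw [pow_succ' (q : ℂ) k] at h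
    rw [div_mul_eq_mul_div, div_mul_eq_mul_div, eq_div_iff (mul_ne_zero h3 h4), pow_succ x]
    linear_combination x ^ k * x * h
  rw [hrec, norm_mul]
  gcongr

theorem hasSum_phiSeries (hq0 : 0 < q) (hq1 : q < 1) (hc : ‖c‖ < 1) {x : ℂ}
    (hx : ‖x‖ < 1) : HasSum (fun k => phiCoeff a b c q k * x ^ k) (phiSeries a b c q x) :=
  (summable_phiCoeff_mul_pow hq0 hq1 hc hx).hasSum

theorem differentiableOn_phiSeries (hq0 : 0 < q) (hq1 : q < 1) (hc : ‖c‖ < 1) :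
    DifferentiableOn ℂ (phiSeries a b c q) {x | ‖x‖ < 1} := by
  intro x hx
  obtain ⟨s, hs1, hs2⟩ := exists_between (show ‖x‖ < 1 from hx)
  have hs0 : 0 ≤ s := (norm_nonneg x).trans hs1.le
  have hsum : Summable fun k => ‖phiCoeff a b c q k * (s : ℂ) ^ k‖ :=
    (summable_phiCoeff_mul_pow hq0 hq1 hc (x := (s : ℂ)) (by
      rwa [norm_real, Real.norm_of_nonneg hs0])).norm
  have hopen : IsOpen {w : ℂ | ‖w‖ < s} := isOpen_lt continuous_norm continuous_const
  have hd : DifferentiableOn ℂ (fun w => ∑' k, phiCoeff a b c q k * w ^ k) {w : ℂ | ‖w‖ < s} := by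
    refine Complex.differentiableOn_tsum_of_summable_norm hsum (fun k => by fun_prop) hopen
      fun k w hw => ?_
    rw [norm_mul, norm_mul, norm_pow, norm_pow, norm_real, Real.norm_of_nonneg hs0]
    have : ‖w‖ < s := hw
    gcongr
  exact (hd.differentiableAt (hopen.mem_nhds hs1)).differentiableWithinAt

theorem norm_ofReal_mul_lt (hq0 : 0 < q) (hq1 : q < 1) {x : ℂ} (hx : ‖x‖ < 1) :
    ‖(q : ℂ) * x‖ < 1 := by
  rw [norm_mul, norm_real, Real.norm_of_nonneg hq0.le]
  nlinarith [norm_nonneg x]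

/-- Replacing x by qx multiplies the k-th coefficient by q^k, so the recursion `phiCoeff_succ` turns
into this functional equation. The coefficients of x⁰ cancel, hence the shift by one in the
comparison. -/
theorem phiSeries_qdiff (hq0 : 0 < q) (hq1 : q < 1) (hc : ‖c‖ < 1) {x : ℂ} (hx : ‖x‖ < 1) :
    q * (1 - x) * phiSeries a b c q x =
      ((c + q) - (a + b) * q * x) * phiSeries a b c q (q * x) -
        (c - a * b * q * x) * phiSeries a b c q (q * (q * x)) := by
  have hx1 := norm_ofReal_mul_lt hq0 hq1 hx
  have h0 := hasSum_phiSeries (a := a) (b := b) hq0 hq1 hc hx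
  have h1 := hasSum_phiSeries (a := a) (b := b) hq0 hq1 hc hx1
  have h2 := hasSum_phiSeries (a := a) (b := b) hq0 hq1 hc (norm_ofReal_mul_lt hq0 hq1 hx1)
  have hA := ((h0.mul_left (q : ℂ)).sub (h1.mul_left (c + q))).add (h2.mul_left c)
  have hB := (((h0.mul_left (q : ℂ)).sub (h1.mul_left ((a + b) * q))).add
    (h2.mul_left (a * b * q))).mul_left x
  rw [← hasSum_nat_add_iff' 1] at hA
  have := hA.unique (hB.congr_fun fun k => ?_)
  · simp only [Finset.range_one, Finset.sum_singleton, pow_zero, mul_one] at this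
    linear_combination this
  · have h := phiCoeff_succ (a := a) (b := b) hq0 hq1 hc k
    simp only [mul_pow, pow_succ] at h ⊢
    linear_combination (q : ℂ) * x * x ^ k * h

end Series

/-! ### Analytic continuation to the cut plane -/

section Continuation

variable {a b c : ℂ} {q : ℝ}

/-- The `n`-fold iterated extension of the `₂φ₁`-series by its `q`-difference equation; it is
defined for `q ^ n * ‖x‖ < 1`. -/
def phiExtend (a b c q : ℂ) : ℕ → ℂ → ℂ
  | 0, x => phiSeries a b c q x
  | n + 1, x => (((c + q) - (a + b) * q * x) * phiExtend a b c q n (q * x) -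
      (c - a * b * q * x) * phiExtend a b c q n (q * (q * x))) / (q * (1 - x))

theorem pow_mul_norm_ofReal_mul_lt (hq0 : 0 < q) {n : ℕ} {x : ℂ}
    (hx : q ^ (n + 1) * ‖x‖ < 1) : q ^ n * ‖(q : ℂ) * x‖ < 1 := by
  rw [norm_mul, norm_real, Real.norm_of_nonneg hq0.le]
  calc q ^ n * (q * ‖x‖) = q ^ (n + 1) * ‖x‖ := by ring
    _ < 1 := hx

theorem pow_succ_mul_norm_lt (hq0 : 0 < q) (hq1 : q < 1) {n : ℕ} {x : ℂ}
    (hx : q ^ n * ‖x‖ < 1) : q ^ (n + 1) * ‖x‖ < 1 := by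
  refine lt_of_le_of_lt ?_ hx
  gcongr ?_ * _
  exact pow_le_pow_of_le_one hq0.le hq1.le n.le_succ

theorem phiExtend_succ_eq (hq0 : 0 < q) (hq1 : q < 1) (hc : ‖c‖ < 1) {n : ℕ} {x : ℂ}
    (hx : q ^ n * ‖x‖ < 1) : phiExtend a b c q (n + 1) x = phiExtend a b c q n x := by
  induction n generalizing x with
  | zero =>
    rw [pow_zero, one_mul] at hx
    have hq : (q : ℂ) ≠ 0 := ofReal_ne_zero.2 hq0.ne'
    have h1 : (1 : ℂ) - x ≠ 0 := by
      intro h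
      rw [← sub_eq_zero.1 h, norm_one] at hx
      exact lt_irrefl _ hx
    simp only [phiExtend]
    rw [← phiSeries_qdiff hq0 hq1 hc hx]
    field_simp
  | succ n ih =>
    have h1 := pow_mul_norm_ofReal_mul_lt hq0 hx
    rw [phiExtend, ih h1, ih (pow_mul_norm_ofReal_mul_lt hq0 (pow_succ_mul_norm_lt hq0 hq1 h1))]
    rfl

theorem phiExtend_eq_of_le (hq0 : 0 < q) (hq1 : q < 1) (hc : ‖c‖ < 1) {m n : ℕ} (hmn : m ≤ n)
    {x : ℂ} (hx : q ^ m * ‖x‖ < 1) : phiExtend a b c q n x = phiExtend a b c q m x := by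
  induction n, hmn using Nat.le_induction with
  | base => rfl
  | succ n hmn ih =>
    rw [← ih]
    refine phiExtend_succ_eq hq0 hq1 hc (lt_of_le_of_lt ?_ hx)
    gcongr ?_ * _
    exact pow_le_pow_of_le_one hq0.le hq1.le hmn

theorem exists_pow_mul_norm_lt (hq0 : 0 < q) (hq1 : q < 1) (x : ℂ) :
    ∃ n : ℕ, q ^ n * ‖x‖ < 1 := by
  have h := (tendsto_pow_atTop_nhds_zero_of_lt_one hq0.le hq1).mul_const ‖x‖
  rw [zero_mul] at h
  exact (h.eventually_lt_const one_pos).exists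

open Classical in
/-- The continuation of the `₂φ₁`-series to the cut plane. -/
def phiContinued (a b c : ℂ) (q : ℝ) (x : ℂ) : ℂ :=
  if h : ∃ n : ℕ, q ^ n * ‖x‖ < 1 then phiExtend a b c q h.choose x else 0

theorem phiContinued_eq (hq0 : 0 < q) (hq1 : q < 1) (hc : ‖c‖ < 1) {n : ℕ} {x : ℂ}
    (hx : q ^ n * ‖x‖ < 1) : phiContinued a b c q x = phiExtend a b c q n x := by
  have h := exists_pow_mul_norm_lt hq0 hq1 x
  rw [phiContinued, dif_pos h, ← phiExtend_eq_of_le hq0 hq1 hc (le_max_left _ n) h.choose_spec,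
    ← phiExtend_eq_of_le hq0 hq1 hc (le_max_right h.choose _) hx]

theorem isOpen_pow_mul_norm_lt (q : ℝ) (n : ℕ) : IsOpen {x : ℂ | q ^ n * ‖x‖ < 1} :=
  isOpen_lt (by fun_prop) continuous_const

/-- The iteration divides only by q(1 - x) at points q^j x, and the cut plane is stable under
multiplication by q and omits 1, so no pole is met. -/
theorem differentiableOn_phiExtend (hq0 : 0 < q) (hq1 : q < 1) (hc : ‖c‖ < 1) (n : ℕ) :
    DifferentiableOn ℂ (phiExtend a b c q n) ({x | q ^ n * ‖x‖ < 1} ∩ cutPlane) := by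
  induction n with
  | zero =>
    refine (differentiableOn_phiSeries hq0 hq1 hc).mono fun x hx => ?_
    simpa using hx.1
  | succ n ih =>
    have hmap1 : Set.MapsTo (fun x : ℂ => (q : ℂ) * x) ({x | q ^ (n + 1) * ‖x‖ < 1} ∩ cutPlane)
        ({x | q ^ n * ‖x‖ < 1} ∩ cutPlane) := fun x hx =>
      ⟨pow_mul_norm_ofReal_mul_lt hq0 hx.1, ofReal_mul_mem_cutPlane hq0 hq1 hx.2⟩
    have hmap2 : Set.MapsTo (fun x : ℂ => (q : ℂ) * (q * x))
        ({x | q ^ (n + 1) * ‖x‖ < 1} ∩ cutPlane) ({x | q ^ n * ‖x‖ < 1} ∩ cutPlane) := fun x hx =>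
      ⟨pow_mul_norm_ofReal_mul_lt hq0 (pow_succ_mul_norm_lt hq0 hq1 (hmap1 hx).1),
        ofReal_mul_mem_cutPlane hq0 hq1 (hmap1 hx).2⟩
    have hd1 := ih.comp (by fun_prop) hmap1
    have hd2 := ih.comp (by fun_prop) hmap2
    refine DifferentiableOn.div (DifferentiableOn.sub (DifferentiableOn.mul (by fun_prop) hd1)
      (DifferentiableOn.mul (by fun_prop) hd2)) (by fun_prop) fun x hx => ?_
    refine mul_ne_zero (ofReal_ne_zero.2 hq0.ne') fun h => one_notMem_cutPlane ?_
    rw [sub_eq_zero.1 h]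
    exact hx.2

theorem isPhiContinuation_phiContinued (hq0 : 0 < q) (hq1 : q < 1) (hc : ‖c‖ < 1) :
    IsPhiContinuation a b c q (phiContinued a b c q) := by
  constructor
  · refine DifferentiableOn.analyticOnNhd (fun x hx => ?_) isOpen_cutPlane
    obtain ⟨n, hn⟩ := exists_pow_mul_norm_lt hq0 hq1 x
    have hmem : {x | q ^ n * ‖x‖ < 1} ∩ cutPlane ∈ 𝓝 x :=
      ((isOpen_pow_mul_norm_lt q n).inter isOpen_cutPlane).mem_nhds ⟨hn, hx⟩
    have hd := (differentiableOn_phiExtend (a := a) (b := b) hq0 hq1 hc n).differentiableAt hmem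
    refine (hd.congr_of_eventuallyEq ?_).differentiableWithinAt
    filter_upwards [hmem] with w hw
    exact phiContinued_eq hq0 hq1 hc hw.1
  · intro x hx
    exact phiContinued_eq hq0 hq1 hc (n := 0) (by simpa using hx)

theorem isPhiContinuation_twoPhiOne (hq0 : 0 < q) (hq1 : q < 1) (hc : ‖c‖ < 1) :
    IsPhiContinuation a b c q (twoPhiOne a b c q) := by
  have h : ∃ φ : ℂ → ℂ, IsPhiContinuation a b c q φ :=
    ⟨_, isPhiContinuation_phiContinued hq0 hq1 hc⟩
  have heq : twoPhiOne a b c q = h.choose := funext fun x => by rw [twoPhiOne, dif_pos h]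
  rw [heq]
  exact h.choose_spec

theorem twoPhiOne_qdiff (hq0 : 0 < q) (hq1 : q < 1) (hc : ‖c‖ < 1) {x : ℂ} (hx : x ∈ cutPlane) :
    q * (1 - x) * twoPhiOne a b c q x =
      ((c + q) - (a + b) * q * x) * twoPhiOne a b c q (q * x) -
        (c - a * b * q * x) * twoPhiOne a b c q (q * (q * x)) := by
  have heq := (isPhiContinuation_twoPhiOne (a := a) (b := b) hq0 hq1 hc).eqOn
    (isPhiContinuation_phiContinued hq0 hq1 hc)
  have hx1 := ofReal_mul_mem_cutPlane hq0 hq1 hx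
  have hx2 := ofReal_mul_mem_cutPlane hq0 hq1 hx1
  rw [heq hx, heq hx1, heq hx2]
  obtain ⟨n, hn⟩ := exists_pow_mul_norm_lt hq0 hq1 x
  have hn' := pow_succ_mul_norm_lt hq0 hq1 hn
  have hn1 := pow_mul_norm_ofReal_mul_lt hq0 hn'
  have hn2 := pow_mul_norm_ofReal_mul_lt hq0 (pow_succ_mul_norm_lt hq0 hq1 hn1)
  -- Taking level n + 1 at x and level n at qx and q²x makes the equation the defining step of
  -- `phiExtend`.
  rw [phiContinued_eq hq0 hq1 hc hn', phiContinued_eq hq0 hq1 hc hn1,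
    phiContinued_eq hq0 hq1 hc hn2, phiExtend]
  have hq : (q : ℂ) ≠ 0 := ofReal_ne_zero.2 hq0.ne'
  have h1 : (1 : ℂ) - x ≠ 0 := by
    intro h
    apply one_notMem_cutPlane
    rwa [sub_eq_zero.1 h]
  field_simp

theorem zero_mem_cutPlane : (0 : ℂ) ∈ cutPlane := by
  simpa using ofReal_mem_cutPlane zero_lt_one

theorem tendsto_twoPhiOne_zero (hq0 : 0 < q) (hq1 : q < 1) (hc : ‖c‖ < 1) :
    Tendsto (twoPhiOne a b c q) (𝓝 0) (𝓝 1) := by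
  have h := isPhiContinuation_twoPhiOne (a := a) (b := b) hq0 hq1 hc
  have h0 : twoPhiOne a b c q 0 = 1 := by
    rw [h.2 0 (by simp), phiSeries, tsum_eq_single 0]
    · simp [qPoch]
    · intro k hk
      simp [hk]
  have := (h.1 0 zero_mem_cutPlane).continuousAt.tendsto
  rwa [h0] at this

end Continuation

/-! ### Infinite products with nonpositive parameter -/

section InfiniteProducts

variable {q A : ℝ}

theorem multipliable_one_sub_mul_pow (hq0 : 0 < q) (hq1 : q < 1) (A : ℝ) :
    Multipliable fun i : ℕ => 1 - A * q ^ i := by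
  have h := ((summable_geometric_of_lt_one hq0.le hq1).mul_left A).neg
  simpa only [sub_eq_add_neg] using Real.multipliable_one_add_of_summable h

theorem qPochInf_eq_mul (hq0 : 0 < q) (hq1 : q < 1) (A : ℝ) :
    qPochInf A q = (1 - A) * qPochInf (A * q) q := by
  have h : ∀ i : ℕ, 1 - A * q ^ (i + 1) = 1 - A * q * q ^ i := fun i => by ring
  rw [qPochInf, tprod_eq_zero_mul', qPochInf]
  · simp only [h, pow_zero, mul_one]
  · simpa only [h] using multipliable_one_sub_mul_pow hq0 hq1 (A * q)

/-- For A ≤ 0 every factor is at least 1. As r < 0, all products attached to the weight are of this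
kind: they have no zeros and their partial products increase. -/
theorem one_le_qPoch (hq0 : 0 < q) (hA : A ≤ 0) (n : ℕ) : 1 ≤ qPoch A q n := by
  induction n with
  | zero => simp [qPoch]
  | succ n ih =>
    rw [qPoch_succ]
    exact one_le_mul_of_one_le_of_one_le ih (by nlinarith [pow_pos hq0 n])

theorem one_le_qPochInf (hq0 : 0 < q) (hq1 : q < 1) (hA : A ≤ 0) : 1 ≤ qPochInf A q :=
  ge_of_tendsto' (multipliable_one_sub_mul_pow hq0 hq1 A).hasProd.tendsto_prod_nat
    fun n => one_le_qPoch hq0 hA n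

theorem qPochInf_eq_qPoch_mul (hq0 : 0 < q) (hq1 : q < 1) (A : ℝ) (n : ℕ) :
    qPochInf A q = qPoch A q n * qPochInf (A * q ^ n) q := by
  induction n with
  | zero => simp [qPoch]
  | succ n ih => rw [ih, qPochInf_eq_mul hq0 hq1 (A * q ^ n), qPoch_succ]; ring_nf

theorem qPoch_le_qPochInf (hq0 : 0 < q) (hq1 : q < 1) (hA : A ≤ 0) (n : ℕ) :
    qPoch A q n ≤ qPochInf A q := by
  rw [qPochInf_eq_qPoch_mul hq0 hq1 A n]
  have h1 := one_le_qPoch hq0 hA n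
  have h2 := one_le_qPochInf hq0 hq1 (A := A * q ^ n) (by nlinarith [pow_pos hq0 n])
  nlinarith

end InfiniteProducts

/-! ### The weight and its growth at both ends -/

section Weight

variable {q r c d : ℝ}

theorem qPochInf_shift (hq0 : 0 < q) (hq1 : q < 1) (e : ℝ) (k : ℤ) :
    qPochInf (e * q ^ (1 - (k + 1))) q =
      (1 - e * q ^ (-k)) * qPochInf (e * q ^ (1 - k)) q := by
  have h : (1 - (k + 1) : ℤ) = -k := by ring
  rw [h, qPochInf_eq_mul hq0 hq1, show (1 - k : ℤ) = -k + 1 by ring, zpow_add_one₀ hq0.ne']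
  ring_nf

theorem mul_div_eq_div_mul_zpow (k : ℤ) : c * q ^ k / (d ^ 2 * r) = c / (d ^ 2 * r) * q ^ k := by
  ring

theorem zpow_div_eq (k : ℤ) : q ^ k / r = 1 / r * q ^ k := by
  ring

theorem coeff_neg (hr : r < 0) (hc : 0 < c) (hd : d ≠ 0) : c / (d ^ 2 * r) < 0 :=
  div_neg_of_pos_of_neg hc (mul_neg_of_pos_of_neg (by positivity) hr)

theorem one_le_one_sub_zpow_div (hq0 : 0 < q) (hr : r < 0) (k : ℤ) : 1 ≤ 1 - q ^ k / r := by
  have := div_neg_of_pos_of_neg (zpow_pos hq0 k) hr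
  linarith

theorem one_le_one_sub_mul_zpow_div (hq0 : 0 < q) (hr : r < 0) (hc : 0 < c) (hd : d ≠ 0) (k : ℤ) :
    1 ≤ 1 - c * q ^ k / (d ^ 2 * r) := by
  rw [mul_div_eq_div_mul_zpow]
  nlinarith [coeff_neg hr hc hd, zpow_pos hq0 k]

theorem coeffA_eq (hq0 : 0 < q) (hr : r < 0) (k : ℤ) :
    coeffA q r c d k = 1 / 2 * (√(1 - q ^ (-k) / r) * √(1 - c * q ^ (-k) / (d ^ 2 * r))) := by
  rw [coeffA, Real.sqrt_mul (zero_le_one.trans (one_le_one_sub_zpow_div hq0 hr _))]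

theorem coeffA_pos (hq0 : 0 < q) (hr : r < 0) (hc : 0 < c) (hd : d ≠ 0) (k : ℤ) :
    0 < coeffA q r c d k := by
  rw [coeffA_eq hq0 hr]
  have h1 := one_le_one_sub_zpow_div hq0 hr (-k)
  have h2 := one_le_one_sub_mul_zpow_div hq0 hr hc hd (-k)
  positivity

theorem one_le_qPochInf_num (hq0 : 0 < q) (hq1 : q < 1) (hr : r < 0) (hc : 0 < c) (hd : d ≠ 0)
    (k : ℤ) : 1 ≤ qPochInf (c * q ^ k / (d ^ 2 * r)) q := by
  refine one_le_qPochInf hq0 hq1 ?_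
  have := one_le_one_sub_mul_zpow_div hq0 hr hc hd k
  linarith

theorem one_le_qPochInf_den (hq0 : 0 < q) (hq1 : q < 1) (hr : r < 0) (k : ℤ) :
    1 ≤ qPochInf (q ^ k / r) q := by
  refine one_le_qPochInf hq0 hq1 ?_
  have := one_le_one_sub_zpow_div hq0 hr k
  linarith

theorem weight_ne_zero (hq0 : 0 < q) (hq1 : q < 1) (hr : r < 0) (hc : 0 < c) (hd : d ≠ 0)
    (k : ℤ) : weight q r c d k ≠ 0 := by
  have h1 := one_le_qPochInf_num hq0 hq1 hr hc hd (1 - k)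
  have h2 := one_le_qPochInf_den hq0 hq1 hr (1 - k)
  rw [weight]
  positivity

theorem weight_succ (hq0 : 0 < q) (hq1 : q < 1) (hr : r < 0) (hc : 0 < c) (hd : d ≠ 0) (k : ℤ) :
    weight q r c d (k + 1) * √(1 - q ^ (-k) / r) =
      d * weight q r c d k * √(1 - c * q ^ (-k) / (d ^ 2 * r)) := by
  have h1 := one_le_qPochInf_num hq0 hq1 hr hc hd (1 - k)
  have h2 := one_le_qPochInf_den hq0 hq1 hr (1 - k)
  have h3 := one_le_one_sub_zpow_div hq0 hr (-k)
  have h4 := one_le_one_sub_mul_zpow_div hq0 hr hc hd (-k)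
  have e1 : qPochInf (c * q ^ (1 - (k + 1)) / (d ^ 2 * r)) q =
      (1 - c * q ^ (-k) / (d ^ 2 * r)) * qPochInf (c * q ^ (1 - k) / (d ^ 2 * r)) q := by
    simp only [mul_div_eq_div_mul_zpow]
    exact qPochInf_shift hq0 hq1 _ k
  have e2 : qPochInf (q ^ (1 - (k + 1)) / r) q =
      (1 - q ^ (-k) / r) * qPochInf (q ^ (1 - k) / r) q := by
    simp only [zpow_div_eq (r := r)]
    exact qPochInf_shift hq0 hq1 _ k
  rw [weight, weight, e1, e2, mul_div_mul_comm, Real.sqrt_mul (by positivity),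
    Real.sqrt_div (by linarith), zpow_add_one₀ hd]
  have : √(1 - q ^ (-k) / r) ≠ 0 := by positivity
  field_simp

theorem coeffA_mul_weight_succ (hq0 : 0 < q) (hq1 : q < 1) (hr : r < 0) (hc : 0 < c) (hd : d ≠ 0)
    (k : ℤ) : coeffA q r c d k * weight q r c d (k + 1) =
      d / 2 * (1 - c * q ^ (-k) / (d ^ 2 * r)) * weight q r c d k := by
  have h4 := one_le_one_sub_mul_zpow_div hq0 hr hc hd (-k)
  rw [coeffA_eq hq0 hr]
  have h := weight_succ hq0 hq1 hr hc hd k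
  have hs := Real.mul_self_sqrt (show 0 ≤ 1 - c * q ^ (-k) / (d ^ 2 * r) by linarith)
  generalize √(1 - c * q ^ (-k) / (d ^ 2 * r)) = t at *
  rw [← hs]
  linear_combination (1 / 2) * t * h

theorem coeffA_mul_weight (hq0 : 0 < q) (hq1 : q < 1) (hr : r < 0) (hc : 0 < c) (hd : d ≠ 0)
    (k : ℤ) : coeffA q r c d k * weight q r c d k =
      1 / (2 * d) * (1 - q ^ (-k) / r) * weight q r c d (k + 1) := by
  have h4 := one_le_one_sub_zpow_div hq0 hr (-k)
  rw [coeffA_eq hq0 hr]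
  have h := weight_succ hq0 hq1 hr hc hd k
  have hs := Real.mul_self_sqrt (show 0 ≤ 1 - q ^ (-k) / r by linarith)
  generalize √(1 - q ^ (-k) / r) = t at *
  rw [← hs]
  have hd' : 1 / (2 * d) * d = 1 / 2 := by field_simp
  generalize √(1 - c * q ^ (-k) / (d ^ 2 * r)) = s at *
  linear_combination -(1 / (2 * d)) * t * h - t * s * weight q r c d k * hd'

/-- Both `a_k w_{k+1}` and `a_{k-1} w_{k-1}` are rational multiples of `w_k`, so division by `w_k`
leaves a recurrence without square roots. -/
theorem weighted_mem_solutions (hq0 : 0 < q) (hq1 : q < 1) (hr : r < 0) (hc : 0 < c) (hd : d ≠ 0)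
    {z : ℂ} {v : ℤ → ℂ}
    (h : ∀ k : ℤ, d / 2 * (1 - c * (q : ℂ) ^ (-k) / (d ^ 2 * r)) * v (k + 1) +
      (q : ℂ) ^ (-k) * (c + q) / (2 * d * r) * v k +
      1 / (2 * d) * (1 - (q : ℂ) ^ (1 - k) / r) * v (k - 1) = z * v k) :
    weighted q r c d v ∈ solutions (coeffA q r c d) (coeffB q r c d) z := by
  rw [mem_solutions_iff]
  intro k
  have h1 := congrArg ofReal (coeffA_mul_weight_succ hq0 hq1 hr hc hd k)
  have h2 := congrArg ofReal (coeffA_mul_weight hq0 hq1 hr hc hd (k - 1))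
  rw [sub_add_cancel, neg_sub] at h2
  push_cast at h1 h2
  simp only [weighted, coeffB]
  push_cast
  linear_combination (weight q r c d k : ℂ) * h k + v (k + 1) * h1 + v (k - 1) * h2

/-- The ratio `w_n² / cⁿ` in terms of finite `q`-shifted factorials. -/
theorem weight_sq_mul_qPoch (hq0 : 0 < q) (hq1 : q < 1) (hr : r < 0) (hc : 0 < c) (hd : d ≠ 0)
    (n : ℕ) : weight q r c d n ^ 2 * qPoch r q n =
      weight q r c d 0 ^ 2 * c ^ n * qPoch (d ^ 2 * r / c) q n := by
  induction n with
  | zero => simp [qPoch]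
  | succ n ih =>
    have h := congrArg (· ^ 2) (weight_succ hq0 hq1 hr hc hd n)
    have h3 := one_le_one_sub_zpow_div hq0 hr (-(n : ℤ))
    have h4 := one_le_one_sub_mul_zpow_div hq0 hr hc hd (-(n : ℤ))
    simp only [mul_pow] at h
    rw [Real.sq_sqrt (by linarith), Real.sq_sqrt (by linarith), zpow_neg, zpow_natCast] at h
    rw [qPoch_succ, qPoch_succ, pow_succ]
    push_cast
    have hqn := (pow_pos hq0 n).ne'
    have hr' := hr.ne
    have key : weight q r c d (n + 1) ^ 2 * (1 - r * q ^ n) =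
        weight q r c d n ^ 2 * (c * (1 - d ^ 2 * r / c * q ^ n)) := by
      field_simp at h ⊢
      linear_combination -h
    linear_combination qPoch r q n * key + c * (1 - d ^ 2 * r / c * q ^ n) * ih

/-- In `weight_sq_mul_qPoch` both finite products lie between 1 and their infinite counterparts, so
w_n² is comparable to c^n. -/
theorem exists_weight_bounds (hq0 : 0 < q) (hq1 : q < 1) (hr : r < 0) (hc : 0 < c) (hd : d ≠ 0) :
    ∃ m M : ℝ, 0 < m ∧ 0 < M ∧ ∀ n : ℕ, m * √c ^ n ≤ |weight q r c d n| ∧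
      |weight q r c d n| ≤ M * √c ^ n := by
  have hα : d ^ 2 * r / c ≤ 0 :=
    div_nonpos_of_nonpos_of_nonneg (mul_nonpos_of_nonneg_of_nonpos (sq_nonneg d) hr.le) hc.le
  have hw0 := weight_ne_zero hq0 hq1 hr hc hd 0
  have hP := one_le_qPochInf hq0 hq1 hr.le
  have hQ := one_le_qPochInf hq0 hq1 hα
  have hsq : ∀ n : ℕ, (√c ^ n) ^ 2 = c ^ n := fun n => by
    rw [← pow_mul, mul_comm, pow_mul, Real.sq_sqrt hc.le]
  refine ⟨√(weight q r c d 0 ^ 2 / qPochInf r q),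
    √(weight q r c d 0 ^ 2 * qPochInf (d ^ 2 * r / c) q), by positivity, by positivity,
    fun n => ?_⟩
  have h := weight_sq_mul_qPoch hq0 hq1 hr hc hd n
  have h1 := one_le_qPoch hq0 hr.le n
  have h2 := one_le_qPoch hq0 hα n
  have h3 := qPoch_le_qPochInf hq0 hq1 hr.le n
  have h4 := qPoch_le_qPochInf hq0 hq1 hα n
  have hcn := pow_pos hc n
  have hpos : 0 < weight q r c d 0 ^ 2 * c ^ n := by positivity
  constructor
  · refine abs_le_of_sq_le_sq' ?_ (abs_nonneg _) |>.2
    rw [mul_pow, hsq, Real.sq_sqrt (by positivity), sq_abs, div_mul_eq_mul_div,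
      div_le_iff₀ (by positivity)]
    calc weight q r c d 0 ^ 2 * c ^ n ≤
        weight q r c d 0 ^ 2 * c ^ n * qPoch (d ^ 2 * r / c) q n := le_mul_of_one_le_right hpos.le h2
      _ = weight q r c d n ^ 2 * qPoch r q n := h.symm
      _ ≤ weight q r c d n ^ 2 * qPochInf r q := by gcongr
  · refine abs_le_of_sq_le_sq' ?_ (by positivity) |>.2
    rw [mul_pow, hsq, Real.sq_sqrt (by positivity), sq_abs]
    calc weight q r c d n ^ 2 ≤ weight q r c d n ^ 2 * qPoch r q n :=
          le_mul_of_one_le_right (sq_nonneg _) h1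
      _ = weight q r c d 0 ^ 2 * c ^ n * qPoch (d ^ 2 * r / c) q n := h
      _ ≤ weight q r c d 0 ^ 2 * c ^ n * qPochInf (d ^ 2 * r / c) q := by gcongr
      _ = _ := by ring

/-- The numerator product increases with k, hence is at most its value at k = 0, and the denominator
product is at least 1. -/
theorem exists_weight_bound_neg (hq0 : 0 < q) (hq1 : q < 1) (hr : r < 0) (hc : 0 < c)
    (hd : d ≠ 0) : ∃ M : ℝ, 0 < M ∧ ∀ k ≤ 0, |weight q r c d k| ≤ M * |d| ^ k := by
  have hmono : Monotone fun k : ℤ => qPochInf (c * q ^ (1 - k) / (d ^ 2 * r)) q := by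
    refine monotone_int_of_le_succ fun k => ?_
    simp only [mul_div_eq_div_mul_zpow]
    rw [qPochInf_shift hq0 hq1]
    have h1 := one_le_one_sub_mul_zpow_div hq0 hr hc hd (-k)
    have h2 := one_le_qPochInf_num hq0 hq1 hr hc hd (1 - k)
    simp only [mul_div_eq_div_mul_zpow] at h1 h2
    exact le_mul_of_one_le_left (by linarith) h1
  have h0 := one_le_qPochInf_num hq0 hq1 hr hc hd (1 - 0)
  refine ⟨√(qPochInf (c * q ^ (1 - 0 : ℤ) / (d ^ 2 * r)) q), by positivity, fun k hk => ?_⟩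
  rw [weight, abs_mul, abs_zpow, abs_of_nonneg (Real.sqrt_nonneg _), mul_comm]
  gcongr
  have h1 := one_le_qPochInf_num hq0 hq1 hr hc hd (1 - k)
  have h2 := one_le_qPochInf_den hq0 hq1 hr (1 - k)
  exact (div_le_self (by linarith) h2).trans (hmono hk)

end Weight

/-! ### Size of the off-diagonal coefficients -/

section CoefficientBounds

variable {q r c d : ℝ}

theorem coeffA_neg_le (hq0 : 0 < q) (hq1 : q < 1) (hr : r < 0) (hc : 0 < c) (hd : d ≠ 0) {k : ℤ}
    (hk : k < 0) : |coeffA q r c d k| ≤ 1 / 2 * √((1 - 1 / r) * (1 - c / (d ^ 2 * r))) := by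
  have hq : q ^ (-k) ≤ 1 := by
    obtain ⟨n, hn⟩ := Int.eq_ofNat_of_zero_le (show 0 ≤ -k by omega)
    rw [hn, zpow_natCast]
    exact pow_le_one₀ hq0.le hq1.le
  have hr1 : 1 / r < 0 := div_neg_of_pos_of_neg one_pos hr
  have hc1 := coeff_neg hr hc hd
  rw [abs_of_pos (coeffA_pos hq0 hr hc hd k), coeffA, mul_div_eq_div_mul_zpow, zpow_div_eq]
  have hq' := zpow_pos hq0 (-k)
  refine mul_le_mul_of_nonneg_left (Real.sqrt_le_sqrt (mul_le_mul ?_ ?_ ?_ ?_)) (by norm_num) <;>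
    nlinarith

theorem coeffA_nonneg_bounds (hq0 : 0 < q) (hq1 : q < 1) (hr : r < 0) (hc : 0 < c) (hd : d ≠ 0)
    (n : ℕ) : 1 / 2 * √((1 / r) * (c / (d ^ 2 * r))) * q⁻¹ ^ n ≤ |coeffA q r c d n| ∧
      |coeffA q r c d n| ≤ 1 / 2 * √((1 - 1 / r) * (1 - c / (d ^ 2 * r))) * q⁻¹ ^ n := by
  have hr1 : 1 / r < 0 := div_neg_of_pos_of_neg one_pos hr
  have hc1 := coeff_neg hr hc hd
  have hq : 1 ≤ q⁻¹ ^ n := one_le_pow₀ ((one_le_inv₀ hq0).2 hq1.le)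
  rw [abs_of_pos (coeffA_pos hq0 hr hc hd n), coeffA, mul_div_eq_div_mul_zpow, zpow_div_eq,
    zpow_neg, zpow_natCast, ← inv_pow]
  generalize q⁻¹ ^ n = Q at hq
  generalize 1 / r = R at hr1
  generalize c / (d ^ 2 * r) = C at hc1
  have hRC : 0 < R * C := mul_pos_of_neg_of_neg hr1 hc1
  have hR : 0 < 1 - R := by linarith
  have hC : 0 < 1 - C := by linarith
  have e : ∀ X : ℝ, √X * Q = √(X * Q ^ 2) := fun X => by
    rw [Real.sqrt_mul' _ (sq_nonneg Q), Real.sqrt_sq (by linarith)]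
  rw [mul_assoc, mul_assoc, e, e]
  have h1 : 1 - R * Q ≤ (1 - R) * Q := by nlinarith
  have h2 : 1 - C * Q ≤ (1 - C) * Q := by nlinarith
  have h3 : 0 ≤ 1 - C * Q := by nlinarith
  constructor
  · refine mul_le_mul_of_nonneg_left (Real.sqrt_le_sqrt ?_) (by norm_num)
    nlinarith
  · refine mul_le_mul_of_nonneg_left (Real.sqrt_le_sqrt ?_) (by norm_num)
    refine (mul_le_mul h1 h2 h3 (by positivity)).trans_eq ?_
    ring

end CoefficientBounds

/-! ### The map μ on the punctured unit disc -/

section Joukowski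

variable {y y' z : ℂ}

theorem ne_zero_of_mu_eq (hz : z.im ≠ 0) (h : mu y = z) : y ≠ 0 := by
  rintro rfl
  apply hz
  rw [← h]
  simp [mu]

theorem norm_ne_one_of_mu_eq (hz : z.im ≠ 0) (h : mu y = z) : ‖y‖ ≠ 1 := by
  intro hy
  apply hz
  rw [← h, mu, inv_eq_conj hy, add_conj]
  simp

/-- The preimages of z are the roots z ± w of y² - 2zy + 1, whose product is 1. Neither is on the
unit circle, where μ is real, so exactly one lies inside. -/
theorem existsUnique_norm_lt_one_mu_eq (hz : z.im ≠ 0) : ∃! y : ℂ, ‖y‖ < 1 ∧ mu y = z := by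
  obtain ⟨w, hw⟩ := IsAlgClosed.exists_pow_nat_eq (z ^ 2 - 1) two_pos
  have hprod : (z + w) * (z - w) = 1 := by linear_combination -hw
  have h1 : z + w ≠ 0 := left_ne_zero_of_mul_eq_one hprod
  have h2 : z - w ≠ 0 := right_ne_zero_of_mul_eq_one hprod
  have hmu1 : mu (z + w) = z := by
    rw [mu, inv_eq_of_mul_eq_one_right hprod]
    ring
  have hmu2 : mu (z - w) = z := by
    rw [mu, inv_eq_of_mul_eq_one_left hprod]
    ring
  have hnorm : ‖z + w‖ * ‖z - w‖ = 1 := by rw [← norm_mul, hprod, norm_one]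
  obtain ⟨y, hy1, hy2⟩ : ∃ y : ℂ, ‖y‖ < 1 ∧ mu y = z := by
    rcases lt_or_ge ‖z + w‖ 1 with h | h
    · exact ⟨_, h, hmu1⟩
    · have h' := lt_of_le_of_ne h (norm_ne_one_of_mu_eq hz hmu1).symm
      refine ⟨z - w, ?_, hmu2⟩
      by_contra! hge
      nlinarith
  refine ⟨y, ⟨hy1, hy2⟩, ?_⟩
  rintro y' ⟨hy1', hy2'⟩
  have hy0 := ne_zero_of_mu_eq hz hy2
  have hy0' := ne_zero_of_mu_eq hz hy2'
  have h : (y' - y) * (y' * y - 1) = 0 := by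
    have := hy2'.trans hy2.symm
    rw [mu, mu] at this
    field_simp at this
    linear_combination this
  rcases mul_eq_zero.1 h with h | h
  · exact sub_eq_zero.1 h
  · have h3 : ‖y'‖ * ‖y‖ = 1 := by rw [← norm_mul, sub_eq_zero.1 h, norm_one]
    nlinarith [norm_nonneg y, norm_nonneg y']

end Joukowski

/-! ### The hypergeometric sequences solve the recurrence -/

section ExplicitSolutions

variable {q r c d : ℝ} {y z : ℂ}

theorem mul_zpow_mem_cutPlane (hq0 : 0 < q) {e : ℝ} (he : e < 0) (k : ℤ) :
    (e : ℂ) * (q : ℂ) ^ k ∈ cutPlane := by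
  have h := ofReal_mem_cutPlane (t := e * q ^ k) (by nlinarith [zpow_pos hq0 k])
  push_cast at h
  exact h

theorem weighted_solf_mem (hq0 : 0 < q) (hq1 : q < 1) (hr : r < 0) (hc : 0 < c) (hc1 : c < 1)
    (hd : d ≠ 0) (hz : z.im ≠ 0) (hy : mu y = z) :
    weighted q r c d (solf q r c d y) ∈ solutions (coeffA q r c d) (coeffB q r c d) z := by
  refine weighted_mem_solutions hq0 hq1 hr hc hd fun k => ?_
  have hq : (q : ℂ) ≠ 0 := ofReal_ne_zero.2 hq0.ne'
  have hd' : (d : ℂ) ≠ 0 := ofReal_ne_zero.2 hd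
  have hr' : (r : ℂ) ≠ 0 := ofReal_ne_zero.2 hr.ne
  have hy0 := ne_zero_of_mu_eq hz hy
  have hcn : ‖(c : ℂ)‖ < 1 := norm_ofReal_lt_one hc hc1
  -- At x = r q^{k-1} the points x, qx, q²x are the arguments for the indices k-1, k, k+1.
  have h := twoPhiOne_qdiff (a := d * y) (b := d / y) hq0 hq1 hcn
    (mul_zpow_mem_cutPlane hq0 hr (k - 1))
  have e1 : (q : ℂ) * (r * (q : ℂ) ^ (k - 1)) = r * (q : ℂ) ^ k := by
    rw [zpow_sub_one₀ hq]
    field_simp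
  have e2 : (q : ℂ) * (r * (q : ℂ) ^ k) = r * (q : ℂ) ^ (k + 1) := by
    rw [zpow_add_one₀ hq]
    ring
  rw [e1, e2] at h
  simp only [solf]
  have e8 : (q : ℂ) ^ (1 - k) = q * ((q : ℂ) ^ k)⁻¹ := by
    rw [sub_eq_add_neg, zpow_add₀ hq, zpow_one, zpow_neg]
  rw [← hy, mu, e8, zpow_neg (q : ℂ) k]
  have e3 : (r : ℂ) * (q : ℂ) ^ (k - 1) = r * ((q : ℂ) ^ k * (q : ℂ)⁻¹) := by
    rw [zpow_sub_one₀ hq]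
  generalize twoPhiOne (d * y) (d / y) c q (r * (q : ℂ) ^ (k - 1)) = u₀ at *
  generalize twoPhiOne (d * y) (d / y) c q (r * (q : ℂ) ^ k) = u₁ at *
  generalize twoPhiOne (d * y) (d / y) c q (r * (q : ℂ) ^ (k + 1)) = u₂ at *
  rw [mul_assoc _ (q : ℂ) (r * (q : ℂ) ^ (k - 1)), mul_assoc _ (q : ℂ) (r * (q : ℂ) ^ (k - 1)),
    e1, e3] at h
  have hQ : (q : ℂ) ^ k ≠ 0 := zpow_ne_zero _ hq
  generalize (q : ℂ) ^ k = Q at *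
  field_simp at h ⊢
  linear_combination -h

theorem norm_sq_div_lt_one (hq0 : 0 < q) (hc : 0 < c) (hqc : q ^ 2 < c) :
    ‖(q : ℂ) ^ 2 / c‖ < 1 := by
  have := norm_ofReal_lt_one (q := q ^ 2 / c) (by positivity) ((div_lt_one hc).2 hqc)
  push_cast at this
  exact this

/-- At x = 0 the q-difference equation for `f` has the characteristic equation q = (c + q)λ - cλ²,
with roots 1 and q/c; `g` belongs to the second root. The hypothesis q² < c keeps its lower
parameter q²/c inside the unit disc. -/
theorem weighted_solg_mem (hq0 : 0 < q) (hq1 : q < 1) (hr : r < 0) (hc : 0 < c) (hqc : q ^ 2 < c)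
    (hd : d ≠ 0) (hz : z.im ≠ 0) (hy : mu y = z) :
    weighted q r c d (solg q r c d y) ∈ solutions (coeffA q r c d) (coeffB q r c d) z := by
  refine weighted_mem_solutions hq0 hq1 hr hc hd fun k => ?_
  have hq : (q : ℂ) ≠ 0 := ofReal_ne_zero.2 hq0.ne'
  have hc' : (c : ℂ) ≠ 0 := ofReal_ne_zero.2 hc.ne'
  have hd' : (d : ℂ) ≠ 0 := ofReal_ne_zero.2 hd
  have hr' : (r : ℂ) ≠ 0 := ofReal_ne_zero.2 hr.ne
  have hy0 := ne_zero_of_mu_eq hz hy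
  have hcn := norm_sq_div_lt_one hq0 hc hqc
  have h := twoPhiOne_qdiff (a := q * d * y / c) (b := q * d / (c * y)) hq0 hq1 hcn
    (mul_zpow_mem_cutPlane hq0 hr (k - 1))
  have e1 : (q : ℂ) * (r * (q : ℂ) ^ (k - 1)) = r * (q : ℂ) ^ k := by
    rw [zpow_sub_one₀ hq]
    field_simp
  have e2 : (q : ℂ) * (r * (q : ℂ) ^ k) = r * (q : ℂ) ^ (k + 1) := by
    rw [zpow_add_one₀ hq]
    ring
  rw [e1, e2] at h
  simp only [solg]
  have e8 : (q : ℂ) ^ (1 - k) = q * ((q : ℂ) ^ k)⁻¹ := by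
    rw [sub_eq_add_neg, zpow_add₀ hq, zpow_one, zpow_neg]
  rw [← hy, mu, e8, zpow_neg (q : ℂ) k]
  have e3 : (r : ℂ) * (q : ℂ) ^ (k - 1) = r * ((q : ℂ) ^ k * (q : ℂ)⁻¹) := by
    rw [zpow_sub_one₀ hq]
  have e4 : (q : ℂ) ^ (k - 1) = (q : ℂ) ^ k * (q : ℂ)⁻¹ := zpow_sub_one₀ hq k
  have e5 : (q : ℂ) ^ (k + 1) = (q : ℂ) ^ k * (q : ℂ) := zpow_add_one₀ hq k
  have e6 : (c : ℂ) ^ (-(k - 1)) = (c : ℂ) ^ (-k) * c := by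
    rw [← zpow_add_one₀ hc']
    ring_nf
  have e7 : (c : ℂ) ^ (-(k + 1)) = (c : ℂ) ^ (-k) * (c : ℂ)⁻¹ := by
    rw [← zpow_sub_one₀ hc']
    ring_nf
  generalize twoPhiOne (q * d * y / c) (q * d / (c * y)) ((q : ℂ) ^ 2 / c) q
    (r * (q : ℂ) ^ (k - 1)) = u₀ at *
  generalize twoPhiOne (q * d * y / c) (q * d / (c * y)) ((q : ℂ) ^ 2 / c) q
    (r * (q : ℂ) ^ k) = u₁ at *
  generalize twoPhiOne (q * d * y / c) (q * d / (c * y)) ((q : ℂ) ^ 2 / c) q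
    (r * (q : ℂ) ^ (k + 1)) = u₂ at *
  rw [mul_assoc _ (q : ℂ) (r * (q : ℂ) ^ (k - 1)), mul_assoc _ (q : ℂ) (r * (q : ℂ) ^ (k - 1)),
    e1, e3] at h
  rw [e4, e5, e6, e7]
  have hQ : (q : ℂ) ^ k ≠ 0 := zpow_ne_zero _ hq
  generalize (c : ℂ) ^ (-k) = K
  generalize (q : ℂ) ^ k = Q at *
  field_simp at h ⊢
  linear_combination -K * h

theorem weighted_solF_mem (hq0 : 0 < q) (hq1 : q < 1) (hr : r < 0) (hc : 0 < c)
    (hd : d ≠ 0) (hz : z.im ≠ 0) (hy : mu y = z) (hy1 : ‖y‖ < 1) :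
    weighted q r c d (solF q r c d y) ∈ solutions (coeffA q r c d) (coeffB q r c d) z := by
  refine weighted_mem_solutions hq0 hq1 hr hc hd fun k => ?_
  have hq : (q : ℂ) ≠ 0 := ofReal_ne_zero.2 hq0.ne'
  have hc' : (c : ℂ) ≠ 0 := ofReal_ne_zero.2 hc.ne'
  have hd' : (d : ℂ) ≠ 0 := ofReal_ne_zero.2 hd
  have hr' : (r : ℂ) ≠ 0 := ofReal_ne_zero.2 hr.ne
  have hy0 := ne_zero_of_mu_eq hz hy
  have hcn : ‖(q : ℂ) * y ^ 2‖ < 1 := norm_ofReal_mul_lt hq0 hq1 (by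
    rw [norm_pow]
    exact pow_lt_one₀ (norm_nonneg y) hy1 two_ne_zero)
  -- Here the argument shrinks as k decreases: the point c q^{-k}/(d²r) belongs to index k+1, and
  -- multiplication by q lowers the index.
  have hx := mul_zpow_mem_cutPlane hq0 (coeff_neg hr hc hd) (-k)
  push_cast at hx
  have e0 : (c / (d ^ 2 * r) : ℂ) * (q : ℂ) ^ (-k) =
      (q : ℂ) ^ (1 - (k + 1)) * c / ((d : ℂ) ^ 2 * r) := by
    rw [show (1 - (k + 1) : ℤ) = -k by ring]
    ring
  have e1 : (q : ℂ) * ((q : ℂ) ^ (1 - (k + 1)) * c / ((d : ℂ) ^ 2 * r)) =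
      (q : ℂ) ^ (1 - k) * c / ((d : ℂ) ^ 2 * r) := by
    rw [show (1 - k : ℤ) = 1 - (k + 1) + 1 by ring, zpow_add_one₀ hq]
    ring
  have e2 : (q : ℂ) * ((q : ℂ) ^ (1 - k) * c / ((d : ℂ) ^ 2 * r)) =
      (q : ℂ) ^ (1 - (k - 1)) * c / ((d : ℂ) ^ 2 * r) := by
    rw [show (1 - (k - 1) : ℤ) = 1 - k + 1 by ring, zpow_add_one₀ hq]
    ring
  rw [e0] at hx
  have h := twoPhiOne_qdiff (a := d * y) (b := q * d * y / c) hq0 hq1 hcn hx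
  rw [e1, e2] at h
  simp only [solF]
  have hdy : (d : ℂ) * y ≠ 0 := mul_ne_zero hd' hy0
  have e6 : ((d : ℂ) * y) ^ (-(k - 1)) = ((d : ℂ) * y) ^ (-k) * (d * y) := by
    rw [← zpow_add_one₀ hdy]
    ring_nf
  have e7 : ((d : ℂ) * y) ^ (-(k + 1)) = ((d : ℂ) * y) ^ (-k) * ((d : ℂ) * y)⁻¹ := by
    rw [← zpow_sub_one₀ hdy]
    ring_nf
  have e3 : (q : ℂ) ^ (1 - (k + 1)) = ((q : ℂ) ^ k)⁻¹ := by
    rw [← zpow_neg]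
    ring_nf
  rw [e6, e7, ← hy, mu]
  generalize twoPhiOne (d * y) (q * d * y / c) (q * y ^ 2) q
    ((q : ℂ) ^ (1 - (k + 1)) * c / ((d : ℂ) ^ 2 * r)) = u₂ at *
  generalize twoPhiOne (d * y) (q * d * y / c) (q * y ^ 2) q
    ((q : ℂ) ^ (1 - k) * c / ((d : ℂ) ^ 2 * r)) = u₁ at *
  generalize twoPhiOne (d * y) (q * d * y / c) (q * y ^ 2) q
    ((q : ℂ) ^ (1 - (k - 1)) * c / ((d : ℂ) ^ 2 * r)) = u₀ at *
  rw [e3] at h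
  rw [show (1 - k : ℤ) = 1 + -k by ring, zpow_add₀ hq, zpow_one, zpow_neg]
  have hQ : (q : ℂ) ^ k ≠ 0 := zpow_ne_zero _ hq
  generalize ((d : ℂ) * y) ^ (-k) = K
  generalize (q : ℂ) ^ k = Q at *
  field_simp at h ⊢
  linear_combination K * h

end ExplicitSolutions

/-! ### Asymptotics and square summability -/

section Asymptotics

variable {q r c d : ℝ} {y z : ℂ}

theorem summable_norm_sq_of_eventually_le {u : ℕ → ℂ} {C ρ : ℝ} (h0 : 0 ≤ ρ) (h1 : ρ < 1)
    (h : ∀ᶠ n in atTop, ‖u n‖ ≤ C * ρ ^ n) : Summable fun n => ‖u n‖ ^ 2 := by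
  have hs : Summable fun n : ℕ => C ^ 2 * (ρ ^ 2) ^ n :=
    (summable_geometric_of_lt_one (sq_nonneg ρ) (pow_lt_one₀ h0 h1 two_ne_zero)).mul_left _
  refine hs.of_norm_bounded_eventually_nat ?_
  filter_upwards [h] with n hn
  rw [Real.norm_of_nonneg (sq_nonneg _)]
  calc ‖u n‖ ^ 2 ≤ (C * ρ ^ n) ^ 2 := by gcongr
    _ = C ^ 2 * (ρ ^ 2) ^ n := by ring

theorem tendsto_mul_pow_zero (hq0 : 0 < q) (hq1 : q < 1) (x : ℂ) :
    Tendsto (fun n : ℕ => x * (q : ℂ) ^ (n : ℤ)) atTop (𝓝 0) := by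
  have := (tendsto_pow_atTop_nhds_zero_of_norm_lt_one (norm_ofReal_lt_one hq0 hq1)).const_mul x
  simpa using this

theorem exists_norm_le_of_tendsto {u : ℕ → ℂ} {l : ℂ} (h : Tendsto u atTop (𝓝 l)) :
    ∃ C, 0 < C ∧ ∀ n, ‖u n‖ ≤ C := by
  obtain ⟨C, hC⟩ := h.norm.bddAbove_range
  exact ⟨max C 1, by positivity, fun n => (hC ⟨n, rfl⟩).trans (le_max_left _ _)⟩

theorem tendsto_solf (hq0 : 0 < q) (hq1 : q < 1) (hc : 0 < c) (hc1 : c < 1) (r d : ℝ) (y : ℂ) :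
    Tendsto (fun n : ℕ => solf q r c d y n) atTop (𝓝 1) :=
  (tendsto_twoPhiOne_zero hq0 hq1 (norm_ofReal_lt_one hc hc1)).comp
    (tendsto_mul_pow_zero hq0 hq1 r)

theorem exists_weighted_solf_bound (hq0 : 0 < q) (hq1 : q < 1) (hr : r < 0) (hc : 0 < c)
    (hc1 : c < 1) (hd : d ≠ 0) (y : ℂ) :
    ∃ C, 0 < C ∧ ∀ n : ℕ, ‖weighted q r c d (solf q r c d y) n‖ ≤ C * √c ^ n := by
  obtain ⟨m, M, -, hM, hw⟩ := exists_weight_bounds hq0 hq1 hr hc hd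
  obtain ⟨C, hC, hf⟩ := exists_norm_le_of_tendsto (tendsto_solf hq0 hq1 hc hc1 r d y)
  refine ⟨M * C, by positivity, fun n => ?_⟩
  rw [weighted, norm_mul, norm_real, Real.norm_eq_abs]
  calc _ ≤ M * √c ^ n * C := by
        gcongr
        · exact (hw n).2
        · exact hf n
    _ = _ := by ring

theorem sqrt_lt_one (hc1 : c < 1) : √c < 1 := by
  rw [Real.sqrt_lt' one_pos]
  simpa using hc1

theorem weighted_solf_mem_solPlus (hq0 : 0 < q) (hq1 : q < 1) (hr : r < 0) (hc : 0 < c)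
    (hc1 : c < 1) (hd : d ≠ 0) (hz : z.im ≠ 0) (hy : mu y = z) :
    weighted q r c d (solf q r c d y) ∈ solPlus (coeffA q r c d) (coeffB q r c d) z := by
  obtain ⟨C, -, hC⟩ := exists_weighted_solf_bound hq0 hq1 hr hc hc1 hd y
  exact ⟨weighted_solf_mem hq0 hq1 hr hc hc1 hd hz hy,
    summable_norm_sq_of_eventually_le (Real.sqrt_nonneg c) (sqrt_lt_one hc1)
      (Eventually.of_forall hC)⟩

theorem weighted_ne_zero (hq0 : 0 < q) (hq1 : q < 1) (hr : r < 0) (hc : 0 < c) (hd : d ≠ 0)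
    {v : ℤ → ℂ} (hv : v ≠ 0) : weighted q r c d v ≠ 0 := by
  obtain ⟨k, hk⟩ := Function.ne_iff.1 hv
  refine Function.ne_iff.2 ⟨k, ?_⟩
  exact mul_ne_zero (ofReal_ne_zero.2 (weight_ne_zero hq0 hq1 hr hc hd k)) hk

theorem solf_ne_zero (hq0 : 0 < q) (hq1 : q < 1) (hc : 0 < c) (hc1 : c < 1) (r d : ℝ) (y : ℂ) :
    solf q r c d y ≠ 0 := by
  intro h
  have := tendsto_solf hq0 hq1 hc hc1 r d y
  rw [h] at this
  exact one_ne_zero (tendsto_nhds_unique this tendsto_const_nhds)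

theorem tendsto_solg (hq0 : 0 < q) (hq1 : q < 1) (hc : 0 < c) (hqc : q ^ 2 < c) (r d : ℝ) (y : ℂ) :
    Tendsto (fun n : ℕ => twoPhiOne (q * d * y / c) (q * d / (c * y)) ((q : ℂ) ^ 2 / c) q
      (r * (q : ℂ) ^ (n : ℤ))) atTop (𝓝 1) :=
  (tendsto_twoPhiOne_zero hq0 hq1 (norm_sq_div_lt_one hq0 hc hqc)).comp
    (tendsto_mul_pow_zero hq0 hq1 r)

theorem solg_natCast (y : ℂ) (n : ℕ) : solg q r c d y n = ((q / c : ℝ) : ℂ) ^ n *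
    twoPhiOne (q * d * y / c) (q * d / (c * y)) ((q : ℂ) ^ 2 / c) q (r * (q : ℂ) ^ (n : ℤ)) := by
  rw [solg, zpow_neg, ← div_eq_mul_inv, zpow_natCast, zpow_natCast, ← div_pow]
  push_cast
  rfl

theorem weighted_solg_mem_solPlus (hq0 : 0 < q) (hq1 : q < 1) (hr : r < 0) (hc : 0 < c)
    (hqc : q ^ 2 < c) (hd : d ≠ 0) (hz : z.im ≠ 0) (hy : mu y = z) :
    weighted q r c d (solg q r c d y) ∈ solPlus (coeffA q r c d) (coeffB q r c d) z := by
  obtain ⟨m, M, -, hM, hw⟩ := exists_weight_bounds hq0 hq1 hr hc hd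
  obtain ⟨C, hC, hg⟩ := exists_norm_le_of_tendsto (tendsto_solg hq0 hq1 hc hqc r d y)
  refine ⟨weighted_solg_mem hq0 hq1 hr hc hqc hd hz hy, ?_⟩
  have hsc : 0 < √c := Real.sqrt_pos.2 hc
  -- The decay rate of `wg` is q/√c, which is below 1 exactly when q² < c.
  have hlt : √c * (q / c) < 1 := by
    have h1 : q < √c := Real.lt_sqrt_of_sq_lt hqc
    rw [mul_div_assoc', div_lt_one hc]
    nlinarith [Real.mul_self_sqrt hc.le]
  refine summable_norm_sq_of_eventually_le (C := M * C) (by positivity) hlt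
    (Eventually.of_forall fun n => ?_)
  rw [weighted, solg_natCast, norm_mul, norm_mul, norm_pow, norm_real, norm_real,
    Real.norm_eq_abs, Real.norm_of_nonneg (by positivity)]
  calc _ ≤ M * √c ^ n * ((q / c) ^ n * C) := by
        gcongr
        · exact (hw n).2
        · exact hg n
    _ = _ := by rw [mul_pow]; ring

theorem tendsto_twoPhiOne_solF (hq0 : 0 < q) (hq1 : q < 1) (r c d : ℝ) (hy1 : ‖y‖ < 1) :
    Tendsto (fun n : ℕ => twoPhiOne (d * y) (q * d * y / c) (q * y ^ 2) q
      ((q : ℂ) ^ (1 - (-(n : ℤ) - 1)) * c / ((d : ℂ) ^ 2 * r))) atTop (𝓝 1) := by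
  have hcn : ‖(q : ℂ) * y ^ 2‖ < 1 := norm_ofReal_mul_lt hq0 hq1 (by
    rw [norm_pow]
    exact pow_lt_one₀ (norm_nonneg y) hy1 two_ne_zero)
  refine (tendsto_twoPhiOne_zero hq0 hq1 hcn).comp ?_
  refine (tendsto_mul_pow_zero hq0 hq1 ((q : ℂ) ^ 2 * c / ((d : ℂ) ^ 2 * r))).congr fun n => ?_
  rw [show (1 - (-(n : ℤ) - 1) : ℤ) = ((n + 2 : ℕ) : ℤ) by push_cast; ring, zpow_natCast,
    zpow_natCast]
  ring

theorem weighted_solF_mem_solMinus (hq0 : 0 < q) (hq1 : q < 1) (hr : r < 0) (hc : 0 < c)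
    (hd : d ≠ 0) (hz : z.im ≠ 0) (hy : mu y = z) (hy1 : ‖y‖ < 1) :
    weighted q r c d (solF q r c d y) ∈ solMinus (coeffA q r c d) (coeffB q r c d) z := by
  obtain ⟨M, hM, hw⟩ := exists_weight_bound_neg hq0 hq1 hr hc hd
  obtain ⟨C, hC, hF⟩ := exists_norm_le_of_tendsto (tendsto_twoPhiOne_solF hq0 hq1 r c d hy1)
  refine ⟨weighted_solF_mem hq0 hq1 hr hc hd hz hy hy1, ?_⟩
  refine summable_norm_sq_of_eventually_le (C := M * ‖y‖ * C) (norm_nonneg y) hy1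
    (Eventually.of_forall fun n => ?_)
  have hd' : |d| ≠ 0 := abs_ne_zero.2 hd
  rw [weighted, solF, norm_mul, norm_mul, norm_zpow, norm_mul, norm_real, norm_real,
    Real.norm_eq_abs, Real.norm_eq_abs]
  calc _ ≤ M * |d| ^ (-(n : ℤ) - 1) * ((|d| * ‖y‖) ^ (-(-(n : ℤ) - 1)) * C) := by
        gcongr
        · exact hw _ (by omega)
        · exact hF n
    _ = M * ‖y‖ ^ (-(-(n : ℤ) - 1)) * C := by
        rw [mul_zpow, zpow_neg |d|]
        have := zpow_ne_zero (-(n : ℤ) - 1) hd'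
        field_simp
    _ = _ := by
        rw [show (-(-(n : ℤ) - 1) : ℤ) = ((n + 1 : ℕ) : ℤ) by push_cast; ring, zpow_natCast]
        ring

theorem solF_ne_zero (hq0 : 0 < q) (hq1 : q < 1) (r c : ℝ) (hd : d ≠ 0) (hy0 : y ≠ 0)
    (hy1 : ‖y‖ < 1) : solF q r c d y ≠ 0 := by
  intro h
  have hF := tendsto_twoPhiOne_solF hq0 hq1 r c d hy1
  have hzero : ∀ n : ℕ, twoPhiOne (d * y) (q * d * y / c) (q * y ^ 2) q
      ((q : ℂ) ^ (1 - (-(n : ℤ) - 1)) * c / ((d : ℂ) ^ 2 * r)) = 0 := fun n => by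
    have := congrFun h (-(n : ℤ) - 1)
    refine (mul_eq_zero.1 this).resolve_left ?_
    exact zpow_ne_zero _ (mul_ne_zero (ofReal_ne_zero.2 hd) hy0)
  simp_rw [hzero] at hF
  exact zero_ne_one (tendsto_nhds_unique tendsto_const_nhds hF)

/-- For t < 1 the limit isolates s₁, after which division by t^n isolates s₂. For t > 1, divide by
t^n and exchange the two sequences. -/
theorem eq_zero_of_combination_eq_zero {s₁ s₂ : ℂ} {t : ℝ} (ht0 : 0 < t) (ht1 : t ≠ 1)
    {u v : ℕ → ℂ} (hu : Tendsto u atTop (𝓝 1)) (hv : Tendsto v atTop (𝓝 1))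
    (h : ∀ n, s₁ * u n + s₂ * ((t : ℂ) ^ n * v n) = 0) : s₁ = 0 ∧ s₂ = 0 := by
  have key : ∀ {s₁ s₂ : ℂ} {t : ℝ} {u v : ℕ → ℂ}, 0 < t → t < 1 → Tendsto u atTop (𝓝 1) →
      Tendsto v atTop (𝓝 1) → (∀ n, s₁ * u n + s₂ * ((t : ℂ) ^ n * v n) = 0) →
      s₁ = 0 ∧ s₂ = 0 := by
    intro s₁ s₂ t u v ht0 ht1 hu hv h
    have hpow := tendsto_pow_atTop_nhds_zero_of_norm_lt_one (norm_ofReal_lt_one ht0 ht1)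
    have hlim := (hu.const_mul s₁).add ((hpow.mul hv).const_mul s₂)
    simp_rw [h] at hlim
    have hs₁ : s₁ = 0 := by
      simpa using (tendsto_nhds_unique tendsto_const_nhds hlim).symm
    refine ⟨hs₁, ?_⟩
    have hz : ∀ n, s₂ * v n = 0 := fun n => by
      have := h n
      rw [hs₁, zero_mul, zero_add] at this
      have ht : (t : ℂ) ^ n ≠ 0 := pow_ne_zero _ (ofReal_ne_zero.2 ht0.ne')
      have h' : (t : ℂ) ^ n * (s₂ * v n) = 0 := by linear_combination this
      exact (mul_eq_zero.1 h').resolve_left ht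
    have hlim2 := hv.const_mul s₂
    simp_rw [hz] at hlim2
    simpa using (tendsto_nhds_unique tendsto_const_nhds hlim2).symm
  rcases lt_or_gt_of_ne ht1 with hlt | hgt
  · exact key ht0 hlt hu hv h
  · refine (key (t := t⁻¹) (inv_pos.2 ht0) (inv_lt_one_of_one_lt₀ hgt) hv hu fun n => ?_).symm
    have ht : (t : ℂ) ^ n ≠ 0 := pow_ne_zero _ (ofReal_ne_zero.2 ht0.ne')
    push_cast
    rw [inv_pow]
    field_simp
    linear_combination h n

theorem linearIndependent_solf_solg (hq0 : 0 < q) (hq1 : q < 1) (hr : r < 0) (hc : 0 < c)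
    (hc1 : c < 1) (hqc : q ^ 2 < c) (hcq : c ≠ q) (hd : d ≠ 0) (y : ℂ) :
    LinearIndependent ℂ ![weighted q r c d (solf q r c d y),
      weighted q r c d (solg q r c d y)] := by
  rw [LinearIndependent.pair_iff]
  intro s₁ s₂ h
  refine eq_zero_of_combination_eq_zero (t := q / c) (by positivity) ?_
    (tendsto_solf hq0 hq1 hc hc1 r d y) (tendsto_solg hq0 hq1 hc hqc r d y) fun n => ?_
  · intro h1
    rw [div_eq_one_iff_eq hc.ne'] at h1
    exact hcq h1.symm
  · have hn := congrFun h n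
    have hw := ofReal_ne_zero.2 (weight_ne_zero hq0 hq1 hr hc hd n)
    simp only [Pi.add_apply, Pi.smul_apply, weighted, smul_eq_mul, Pi.zero_apply] at hn
    rw [← solg_natCast]
    refine (mul_eq_zero.1 (?_ : (weight q r c d n : ℂ) * _ = 0)).resolve_left hw
    linear_combination hn

/-- In the case `c = q` every solution is square summable at plus infinity. -/
theorem solutions_le_solPlus_of_eq (hq0 : 0 < q) (hq1 : q < 1) (hr : r < 0) (hd : d ≠ 0)
    (hz : z.im ≠ 0) (hy : mu y = z) :
    solutions (coeffA q r q d) (coeffB q r q d) z ≤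
      solPlus (coeffA q r q d) (coeffB q r q d) z := by
  intro u hu
  refine ⟨hu, ?_⟩
  set p := weighted q r q d (solf q r q d y) with hp
  have hpsol : p ∈ solutions (coeffA q r q d) (coeffB q r q d) z :=
    weighted_solf_mem hq0 hq1 hr hq0 hq1 hd hz hy
  obtain ⟨C, hC0, hC⟩ := exists_weighted_solf_bound hq0 hq1 hr hq0 hq1 hd y
  obtain ⟨m, M, hm, -, hw⟩ := exists_weight_bounds hq0 hq1 hr hq0 hd
  -- The factor 1/2 comes from |f_n| → 1, which makes |f_n| > 1/2 eventually.
  have hlow : ∀ᶠ n : ℕ in atTop, m / 2 * √q ^ n ≤ ‖p n‖ := by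
    have h1 := (tendsto_solf hq0 hq1 hq0 hq1 r d y).norm
    rw [norm_one] at h1
    filter_upwards [h1.eventually_const_lt one_half_lt_one] with n hn
    rw [hp, weighted, norm_mul, norm_real, Real.norm_eq_abs]
    calc m / 2 * √q ^ n = m * √q ^ n * (1 / 2) := by ring
      _ ≤ _ := by
        gcongr
        exact (hw n).1
  obtain ⟨K, hK⟩ := eventually_atTop.1 hlow
  have hsq : 0 < √q := Real.sqrt_pos.2 hq0
  set B : ℝ := 1 / 2 * √((1 / r) * (q / (d ^ 2 * r))) with hB
  have hBpos : 0 < B := by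
    have h1 : 1 / r < 0 := div_neg_of_pos_of_neg one_pos hr
    have h2 := mul_pos_of_neg_of_neg h1 (coeff_neg hr hq0 hd)
    positivity
  -- Lower bound for a_n |p_n p_{n+1}|: the growth q^{-n} of a_n cancels √q^n √q^{n+1} up to the
  -- factor √q.
  set δ : ℝ := B * (m / 2) ^ 2 * √q with hδ
  have hδpos : 0 < δ := by positivity
  set D : ℝ := ‖wronskian (coeffA q r q d) u p 0‖ / δ with hD
  have hppos : ∀ n ≥ K, 0 < ‖p n‖ := fun n hn => lt_of_lt_of_le (by positivity) (hK n hn)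
  -- Reduction of order: u_{n+1}/p_{n+1} - u_n/p_n is the constant Wronskian divided by a_n p_n
  -- p_{n+1}, hence at most D in modulus, and |u_n/p_n| grows at most linearly.
  have hstep : ∀ n ≥ K, ‖u (n + 1 : ℕ)‖ / ‖p (n + 1 : ℕ)‖ ≤ ‖u n‖ / ‖p n‖ + D := by
    intro n hn
    have hp0 := hppos n hn
    have hp1 := hppos (n + 1) (by omega)
    have ha := (coeffA_nonneg_bounds hq0 hq1 hr hq0 hd n).1
    have hden : δ ≤ |coeffA q r q d n| * (‖p n‖ * ‖p (n + 1 : ℕ)‖) := by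
      calc δ = B * q⁻¹ ^ n * ((m / 2 * √q ^ n) * (m / 2 * √q ^ (n + 1))) := by
            have : q⁻¹ ^ n * (√q ^ n * √q ^ n) = 1 := by
              rw [← mul_pow, Real.mul_self_sqrt hq0.le, ← mul_pow, inv_mul_cancel₀ hq0.ne', one_pow]
            rw [hδ, pow_succ √q]
            linear_combination -(B * (m / 2) ^ 2 * √q) * this
        _ ≤ _ := by
            gcongr
            · exact hK n hn
            · exact hK (n + 1) (by omega)
    have hW := wronskian_eq hu hpsol n
    have hineq : |coeffA q r q d n| * (‖u (n + 1 : ℕ)‖ * ‖p n‖) ≤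
        |coeffA q r q d n| * (‖u n‖ * ‖p (n + 1 : ℕ)‖) +
          ‖wronskian (coeffA q r q d) u p 0‖ := by
      rw [← hW, wronskian, norm_mul, norm_real, Real.norm_eq_abs, ← mul_add, ← norm_mul, ← norm_mul]
      push_cast
      gcongr
      have := norm_add_le (u n * p (n + 1)) (u (n + 1) * p n - u n * p (n + 1))
      rwa [add_sub_cancel] at this
    have hWD : ‖wronskian (coeffA q r q d) u p 0‖ ≤
        |coeffA q r q d n| * (D * (‖p n‖ * ‖p (n + 1 : ℕ)‖)) := by
      have h1 : ‖wronskian (coeffA q r q d) u p 0‖ = D * δ := by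
        rw [hD, div_mul_cancel₀ _ hδpos.ne']
      have hD0 : 0 ≤ D := by positivity
      rw [h1]
      nlinarith [mul_le_mul_of_nonneg_left hden hD0]
    have ha0 : 0 < |coeffA q r q d n| := abs_pos.2 (coeffA_pos hq0 hr hq0 hd n).ne'
    have hfin : ‖u (n + 1 : ℕ)‖ * ‖p n‖ ≤ ‖u n‖ * ‖p (n + 1 : ℕ)‖ +
        D * (‖p n‖ * ‖p (n + 1 : ℕ)‖) := by
      refine le_of_mul_le_mul_left ?_ ha0
      rw [mul_add]
      linarith
    rw [div_add' _ _ _ hp0.ne', div_le_div_iff₀ hp1 hp0]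
    linarith
  have hgrow : ∀ n ≥ K, ‖u n‖ / ‖p n‖ ≤ ‖u K‖ / ‖p K‖ + D * n := by
    intro n hn
    induction n, hn using Nat.le_induction with
    | base =>
      have : 0 ≤ D * K := by positivity
      linarith
    | succ n hn ih =>
      have := hstep n hn
      push_cast at this ⊢
      linarith
  -- A rate ρ strictly between √q and 1 absorbs the linear factor.
  obtain ⟨ρ, hρ1, hρ2⟩ := exists_between (sqrt_lt_one hq1)
  have hρ0 : 0 < ρ := hsq.trans hρ1
  have hratio : √q / ρ < 1 := (div_lt_one hρ0).2 hρ1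
  have hlim : Tendsto (fun n : ℕ => (‖u K‖ / ‖p K‖ + D * n) * (√q / ρ) ^ n) atTop (𝓝 0) := by
    have h1 := (tendsto_pow_atTop_nhds_zero_of_lt_one (by positivity) hratio).const_mul
      (‖u K‖ / ‖p K‖)
    have h2 := (tendsto_self_mul_const_pow_of_lt_one (by positivity) hratio).const_mul D
    have := h1.add h2
    simp only [mul_zero, add_zero] at this
    refine this.congr fun n => by ring
  refine summable_norm_sq_of_eventually_le (C := C) hρ0.le hρ2 ?_
  filter_upwards [hlim.eventually_lt_const one_pos, eventually_ge_atTop K] with n hn hnK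
  have hp0 := hppos n hnK
  have h1 := hgrow n hnK
  rw [div_le_iff₀ hp0] at h1
  have hE : 0 ≤ ‖u K‖ / ‖p K‖ + D * n := by positivity
  calc ‖u n‖ ≤ (‖u K‖ / ‖p K‖ + D * n) * ‖p n‖ := h1
    _ ≤ (‖u K‖ / ‖p K‖ + D * n) * (C * √q ^ n) := by
        gcongr
        exact hC n
    _ = C * ρ ^ n * ((‖u K‖ / ‖p K‖ + D * n) * (√q / ρ) ^ n) := by
        rw [div_pow]
        field_simp
    _ ≤ C * ρ ^ n * 1 := by gcongr
    _ = C * ρ ^ n := mul_one _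

end Asymptotics

/-! ### Dimensions of S⁻, S⁺ and the deficiency spaces -/

section Main

variable {q r c d : ℝ} {y z : ℂ}

theorem coeffA_ne_zero (hq0 : 0 < q) (hr : r < 0) (hc : 0 < c) (hd : d ≠ 0) (k : ℤ) :
    coeffA q r c d k ≠ 0 :=
  (coeffA_pos hq0 hr hc hd k).ne'

theorem solMinus_eq_span (hq0 : 0 < q) (hq1 : q < 1) (hr : r < 0) (hc : 0 < c) (hd : d ≠ 0)
    (hz : z.im ≠ 0) (hy1 : ‖y‖ < 1) (hy : mu y = z) :
    Module.finrank ℂ (solMinus (coeffA q r c d) (coeffB q r c d) z) = 1 ∧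
      solMinus (coeffA q r c d) (coeffB q r c d) z =
        Submodule.span ℂ {weighted q r c d (solF q r c d y)} := by
  have hmem := weighted_solF_mem_solMinus hq0 hq1 hr hc hd hz hy hy1
  exact finrank_and_eq_span_of_wronskian (coeffA_ne_zero hq0 hr hc hd) solMinus_le_solutions hmem
    (weighted_ne_zero hq0 hq1 hr hc hd
      (solF_ne_zero hq0 hq1 r c hd (ne_zero_of_mu_eq hz hy) hy1))
    fun u hu => wronskian_eq_zero_of_mem_solMinus
      (fun k hk => coeffA_neg_le hq0 hq1 hr hc hd hk) hu hmem

theorem sqrt_le_of_le_sq (hq0 : 0 < q) (hcq : c ≤ q ^ 2) : √c ≤ q :=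
  (Real.sqrt_le_left hq0.le).2 hcq

theorem lt_one_of_le_sq (hq0 : 0 < q) (hq1 : q < 1) (hcq : c ≤ q ^ 2) : c < 1 :=
  hcq.trans_lt (pow_lt_one₀ hq0.le hq1 two_ne_zero)

/-- The products are O((√c/q)^n); this is where the threshold c ≤ q² enters. -/
theorem exists_coeffA_mul_weighted_solf_le (hq0 : 0 < q) (hq1 : q < 1) (hr : r < 0) (hc : 0 < c)
    (hcq : c ≤ q ^ 2) (hd : d ≠ 0) (y : ℂ) :
    ∃ A, ∀ n : ℕ, |coeffA q r c d n| * ‖weighted q r c d (solf q r c d y) n‖ ≤ A ∧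
      |coeffA q r c d n| * ‖weighted q r c d (solf q r c d y) (n + 1)‖ ≤ A := by
  have hc1 := lt_one_of_le_sq hq0 hq1 hcq
  obtain ⟨C, hC0, hC⟩ := exists_weighted_solf_bound hq0 hq1 hr hc hc1 hd y
  have key : ∀ (n : ℕ) (t : ℝ), 0 ≤ t → t ≤ C * √c ^ n → |coeffA q r c d n| * t ≤
      1 / 2 * √((1 - 1 / r) * (1 - c / (d ^ 2 * r))) * C := by
    intro n t ht0 ht
    calc |coeffA q r c d n| * t ≤
        1 / 2 * √((1 - 1 / r) * (1 - c / (d ^ 2 * r))) * q⁻¹ ^ n * (C * √c ^ n) := by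
          gcongr
          exact (coeffA_nonneg_bounds hq0 hq1 hr hc hd n).2
      _ = 1 / 2 * √((1 - 1 / r) * (1 - c / (d ^ 2 * r))) * C * (q⁻¹ * √c) ^ n := by
          rw [mul_pow]
          ring
      _ ≤ _ := by
          refine mul_le_of_le_one_right (by positivity) (pow_le_one₀ (by positivity) ?_)
          rw [inv_mul_le_iff₀ hq0, mul_one]
          exact sqrt_le_of_le_sq hq0 hcq
  refine ⟨_, fun n => ⟨key n _ (norm_nonneg _) (hC n), key n _ (norm_nonneg _) ?_⟩⟩
  have h := hC (n + 1)
  push_cast at h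
  refine h.trans (mul_le_mul_of_nonneg_left ?_ hC0.le)
  exact pow_le_pow_of_le_one (Real.sqrt_nonneg c) (sqrt_lt_one hc1).le n.le_succ

theorem solPlus_eq_span (hq0 : 0 < q) (hq1 : q < 1) (hr : r < 0) (hc : 0 < c) (hcq : c ≤ q ^ 2)
    (hd : d ≠ 0) (hz : z.im ≠ 0) (hy : mu y = z) :
    Module.finrank ℂ (solPlus (coeffA q r c d) (coeffB q r c d) z) = 1 ∧
      solPlus (coeffA q r c d) (coeffB q r c d) z =
        Submodule.span ℂ {weighted q r c d (solf q r c d y)} := by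
  have hc1 := lt_one_of_le_sq hq0 hq1 hcq
  have hmem := weighted_solf_mem_solPlus hq0 hq1 hr hc hc1 hd hz hy
  obtain ⟨A, hA⟩ := exists_coeffA_mul_weighted_solf_le hq0 hq1 hr hc hcq hd y
  exact finrank_and_eq_span_of_wronskian (coeffA_ne_zero hq0 hr hc hd) solPlus_le_solutions hmem
    (weighted_ne_zero hq0 hq1 hr hc hd (solf_ne_zero hq0 hq1 hc hc1 r d y))
    fun u hu => wronskian_eq_zero_of_bounded hu hmem.1 hA

/-- Two linearly independent solutions fill the two-dimensional solution space; independence needs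
the rates 1 and q/c to differ. -/
theorem span_solf_solg_eq_solutions (hq0 : 0 < q) (hq1 : q < 1) (hr : r < 0) (hc : 0 < c)
    (hqc : q ^ 2 < c) (hc1 : c < 1) (hcq : c ≠ q) (hd : d ≠ 0) (hz : z.im ≠ 0) (hy : mu y = z) :
    Submodule.span ℂ {weighted q r c d (solf q r c d y), weighted q r c d (solg q r c d y)} =
      solutions (coeffA q r c d) (coeffB q r c d) z := by
  have ha := coeffA_ne_zero (q := q) (r := r) (c := c) (d := d) hq0 hr hc hd
  have := finiteDimensional_solutions (b := coeffB q r c d) (z := z) ha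
  apply Submodule.eq_of_le_of_finrank_eq
  · rw [Submodule.span_le, Set.insert_subset_iff, Set.singleton_subset_iff]
    exact ⟨weighted_solf_mem hq0 hq1 hr hc hc1 hd hz hy,
      weighted_solg_mem hq0 hq1 hr hc hqc hd hz hy⟩
  · have h := finrank_span_eq_card (linearIndependent_solf_solg hq0 hq1 hr hc hc1 hqc hcq hd y)
    rw [Matrix.range_cons_cons_empty, Fintype.card_fin] at h
    rw [finrank_solutions ha]
    exact h

theorem solPlus_eq_solutions (hq0 : 0 < q) (hq1 : q < 1) (hr : r < 0) (hc : 0 < c)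
    (hqc : q ^ 2 < c) (hc1 : c < 1) (hd : d ≠ 0) (hz : z.im ≠ 0) (hy : mu y = z) :
    solPlus (coeffA q r c d) (coeffB q r c d) z =
      solutions (coeffA q r c d) (coeffB q r c d) z := by
  refine le_antisymm solPlus_le_solutions ?_
  rcases eq_or_ne c q with rfl | hcq
  · exact solutions_le_solPlus_of_eq hq0 hq1 hr hd hz hy
  · rw [← span_solf_solg_eq_solutions hq0 hq1 hr hc hqc hc1 hcq hd hz hy, Submodule.span_le,
      Set.insert_subset_iff, Set.singleton_subset_iff]
    exact ⟨weighted_solf_mem_solPlus hq0 hq1 hr hc hc1 hd hz hy,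
      weighted_solg_mem_solPlus hq0 hq1 hr hc hqc hd hz hy⟩

theorem rank_deficiencySpace_eq_one (hq0 : 0 < q) (hq1 : q < 1) (hr : r < 0) (hc : 0 < c)
    (hqc : q ^ 2 < c) (hc1 : c < 1) (hd : d ≠ 0) (hz : z.im ≠ 0) :
    Module.rank ℂ (deficiencySpace (jacobiOperator (coeffA q r c d) (coeffB q r c d)) z) = 1 := by
  obtain ⟨y, ⟨hy1, hy⟩, -⟩ := existsUnique_norm_lt_one_mu_eq hz
  rw [(deficiencySpaceEquiv _ _ z).rank_eq,
    solPlus_eq_solutions hq0 hq1 hr hc hqc hc1 hd hz hy,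
    inf_eq_right.2 solMinus_le_solutions]
  exact Module.rank_eq_one_iff_finrank_eq_one.2 (solMinus_eq_span hq0 hq1 hr hc hd hz hy1 hy).1

theorem deficiencySpace_eq_bot (hq0 : 0 < q) (hq1 : q < 1) (hr : r < 0) (hc : 0 < c)
    (hcq : c ≤ q ^ 2) (hd : d ≠ 0) (hz : z.im ≠ 0) :
    deficiencySpace (jacobiOperator (coeffA q r c d) (coeffB q r c d)) z = ⊥ := by
  obtain ⟨y, ⟨-, hy⟩, -⟩ := existsUnique_norm_lt_one_mu_eq hz
  rw [eq_bot_iff]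
  intro v hv
  have hu : (v : ℤ → ℂ) ∈ solPlus (coeffA q r c d) (coeffB q r c d) z ⊓
      solMinus (coeffA q r c d) (coeffB q r c d) z := by
    rw [← deficiencySpace_jacobiOperator_map]
    exact Submodule.mem_map_of_mem (f := coeFnLinearMap) hv
  obtain ⟨hplus, hminus⟩ := hu
  obtain ⟨A, hA⟩ := exists_coeffA_mul_weighted_solf_le hq0 hq1 hr hc hcq hd y
  obtain ⟨s, hs⟩ : ∃ s : ℂ, s • weighted q r c d (solf q r c d y) = v := by
    rw [← Submodule.mem_span_singleton, ← (solPlus_eq_span hq0 hq1 hr hc hcq hd hz hy).2]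
    exact hplus
  -- `v` is a multiple of `wf`, so a_n |v_{n+1}| is bounded while v_n tends to 0.
  have hpos : Tendsto (fun n : ℕ => currentIm (coeffA q r c d) v n) atTop (𝓝 0) := by
    have hlim := (tendsto_norm_of_mem_solPlus hplus).const_mul (‖s‖ * A)
    rw [mul_zero] at hlim
    refine squeeze_zero_norm (fun n => ?_) hlim
    rw [Real.norm_eq_abs]
    refine (abs_currentIm_le _ _).trans ?_
    rw [← mul_assoc]
    refine mul_le_mul_of_nonneg_right ?_ (norm_nonneg _)
    have h := mul_le_mul_of_nonneg_left (hA n).2 (norm_nonneg s)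
    rw [← hs, Pi.smul_apply, norm_smul]
    linarith
  have hneg : Tendsto (fun n : ℕ => currentIm (coeffA q r c d) v (-(n : ℤ) - 2)) atTop (𝓝 0) := by
    have h1 := tendsto_norm_of_mem_solMinus hminus
    have h2 := h1.comp (tendsto_add_atTop_nat 1)
    have hlim := (h1.mul h2).const_mul (1 / 2 * √((1 - 1 / r) * (1 - c / (d ^ 2 * r))))
    rw [mul_zero, mul_zero] at hlim
    refine squeeze_zero_norm (fun n => ?_) hlim
    rw [Real.norm_eq_abs]
    refine (abs_currentIm_le _ _).trans ?_
    have e1 : -(n : ℤ) - 2 + 1 = -(n : ℤ) - 1 := by ring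
    have e2 : -((n + 1 : ℕ) : ℤ) - 1 = -(n : ℤ) - 2 := by push_cast; ring
    simp only [Function.comp, e1, e2]
    gcongr
    exact coeffA_neg_le hq0 hq1 hr hc hd (by omega)
  exact lp.ext (solution_eq_zero_of_current hz hplus.1 hneg hpos)

end Main

end DoublyInfiniteJacobi

end

open DoublyInfiniteJacobi

theorem proposition4p5p18 (q r c d : ℝ) (hq0 : 0 < q) (hq1 : q < 1) (hr : r < 0) (hc : 0 < c)
    (hd : d ≠ 0) :
    -- essential self-adjointness and deficiency indices
    (c ≤ q ^ 2 → IsEssentiallySelfAdjoint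
      (jacobiOperator (coeffA q r c d)
        (coeffB q r c d))) ∧
    (q ^ 2 < c → c < 1 → HasDeficiencyIndices
      (jacobiOperator (coeffA q r c d)
        (coeffB q r c d)) 1 1) ∧
    ∀ z : ℂ, z.im ≠ 0 →
      -- the space of solutions that are square summable at minus infinity
      (∃! y : ℂ, ‖y‖ < 1 ∧ mu y = z) ∧
      (∀ y : ℂ, ‖y‖ < 1 → mu y = z →
        Module.finrank ℂ (solMinus (coeffA q r c d)
          (coeffB q r c d) z) = 1 ∧
        solMinus (coeffA q r c d)
          (coeffB q r c d) z =
        Submodule.span ℂ {weighted q r c d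
          (solF q r c d y)}) ∧
      -- the space of solutions that are square summable at plus infinity
      (∀ y : ℂ, mu y = z →
        (c ≤ q ^ 2 →
          Module.finrank ℂ (solPlus (coeffA q r c d)
            (coeffB q r c d) z) = 1 ∧
          solPlus (coeffA q r c d)
            (coeffB q r c d) z =
          Submodule.span ℂ {weighted q r c d
            (solf q r c d y)}) ∧
        (q ^ 2 < c → c < 1 →
          Module.finrank ℂ (solPlus (coeffA q r c d)
            (coeffB q r c d) z) = 2 ∧
          (c ≠ q →
            solPlus (coeffA q r c d)
              (coeffB q r c d) z =
            Submodule.span ℂ {weighted q r c d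
                (solf q r c d y),
              weighted q r c d
                (solg q r c d y)}))) := by
  have hI : Complex.I.im ≠ 0 := by simp
  have hI' : (-Complex.I).im ≠ 0 := by simp
  refine ⟨fun hcq => ?_, fun hqc hc1 => ?_, fun z hz => ⟨existsUnique_norm_lt_one_mu_eq hz,
    fun y hy1 hy => solMinus_eq_span hq0 hq1 hr hc hd hz hy1 hy,
    fun y hy => ⟨fun hcq => solPlus_eq_span hq0 hq1 hr hc hcq hd hz hy, fun hqc hc1 => ?_⟩⟩⟩
  · exact isEssentiallySelfAdjoint_of_deficiencySpace_eq_bot (dense_domain_jacobiOperator _ _)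
      (jacobiOperator_isFormalAdjoint _ _) (deficiencySpace_eq_bot hq0 hq1 hr hc hcq hd hI)
      (deficiencySpace_eq_bot hq0 hq1 hr hc hcq hd hI')
  · refine ⟨dense_domain_jacobiOperator _ _, jacobiOperator_isFormalAdjoint _ _, ?_, ?_⟩
    · rw [Nat.cast_one]
      exact rank_deficiencySpace_eq_one hq0 hq1 hr hc hqc hc1 hd hI
    · rw [Nat.cast_one]
      exact rank_deficiencySpace_eq_one hq0 hq1 hr hc hqc hc1 hd hI'
  · have hsol := solPlus_eq_solutions hq0 hq1 hr hc hqc hc1 hd hz hy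
    refine ⟨?_, fun hcq => ?_⟩
    · rw [hsol]
      exact finrank_solutions (coeffA_ne_zero hq0 hr hc hd)
    · rw [hsol]
      exact (span_solf_solg_eq_solutions hq0 hq1 hr hc hqc hc1 hcq hd hz hy).symm
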